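/- Let $F=\mathbb F_q$ be a finite field of characteristic $p$ and let $M=t\cdot p^r$ be a positive integer, where $r\ge 0$ and $p\nmid t$. For $n\ge 1$ let $a_n$ be the number of $x\in \mathrm{GL}_n(q)$ with $x^M=1$. Then, as formal power series in $z$, $$1+\sum_{n=1}^{\infty}\frac{a_n}{|\mathrm{GL}_n(q)|}z^n=\prod_{d\mid t}\left(1+\sum_{m\ge 1}\ \sum_{\substack{\lambda\vdash m\\ \lambda_1\le p^r}}\frac{z^{m\,e(d)}}{q^{e(d)\sum_i(\lambda_i')^2}\prod_{i\ge 1}\left(\frac{1}{q^{e(d)}}\right)_{m_i(\lambda)}}\right)^{\phi(d)/e(d)}.$$ Here $d$ runs over the positive divisors of $t$; $e(d)$ is the order of $q$ in the group $(\mathbb Z/d\mathbb Z)^\times$ (so $e(1)=1$); $\phi$ is Euler's totient function (so $\phi(d)/e(d)$ is an integer); $\lambda$ runs over the partitions of $m$ with largest part $\lambda_1\le p^r$; $\lambda'$ is the transpose of $\lambda$, so that $\lambda_i'$ is the number of parts of $\lambda$ that are at least $i$; $m_i(\lambda)$ is the number of parts of $\lambda$ equal to $i$; and $\left(\frac1Q\right)_k=\left(1-\frac1Q\right)\left(1-\frac1{Q^2}\right)\cdots\left(1-\frac1{Q^k}\right)$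 for $k\ge 0$. -/

import Mathlib

namespace RootsOfIdentity

/-- The multiplicative order `e(d)` of `q` modulo `d`. For `q` prime to `d` this is the order of `q`
in the unit group `(ℤ/dℤ)ˣ`; in particular `e(1) = 1`. -/
noncomputable def ordMod (q d : ℕ) : ℕ := orderOf (q : ZMod d)

/-- `e(d)` is the order of `q` in the group of units of `ℤ/dℤ`. -/
theorem ordMod_eq_orderOf_unit {q d : ℕ} (h : q.Coprime d) :
    ordMod q d = orderOf (ZMod.unitOfCoprime q h) := by
  rw [ordMod, ← orderOf_units, ZMod.coe_unitOfCoprime]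

/-- The exponent `φ(d) / e(d)` is an honest integer quotient. -/
theorem ordMod_dvd_totient {q d : ℕ} (h : q.Coprime d) : ordMod q d ∣ d.totient := by
  refine orderOf_dvd_of_pow_eq_one ?_
  rw [← ZMod.coe_unitOfCoprime q h, ← Units.val_pow_eq_pow_val, ZMod.pow_totient, Units.val_one]

/-- `(1/Q)_i = (1 - 1/Q)(1 - 1/Q²) ⋯ (1 - 1/Qⁱ)`. -/
def invPoch (Q : ℚ) (i : ℕ) : ℚ := ∏ j ∈ Finset.Icc 1 i, (1 - 1 / Q ^ j)

/-- The `i`-th part `λ'_i` (`i ≥ 1`) of the transpose of `λ`: the number of parts of `λ`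
that are at least `i`. -/
def transposePart {m : ℕ} (lam : m.Partition) (i : ℕ) : ℕ :=
  (lam.parts.filter (fun k => i ≤ k)).card

/-- `Q ^ (∑ᵢ (λ'_i)²) * ∏ᵢ (1/Q)_{m_i(λ)}`, where `m_i(λ)` is the multiplicity of the part `i`.
For `i > m` both `λ'_i` and `m_i(λ)` vanish. -/
def centralizerWeight (Q : ℚ) {m : ℕ} (lam : m.Partition) : ℚ :=
  Q ^ (∑ i ∈ Finset.Icc 1 m, transposePart lam i ^ 2) *
    ∏ i ∈ Finset.Icc 1 m, invPoch Q (lam.parts.count i)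

/-- The power series `1 + ∑_{m ≥ 1} ∑_{λ ⊢ m, λ₁ ≤ s} z ^ (m * e) / centralizerWeight (q ^ e) λ`
(for `e ≥ 1`), given by its coefficients. -/
noncomputable def partitionFactor (q e s : ℕ) : PowerSeries ℚ :=
  1 + PowerSeries.mk fun k =>
    ∑ m ∈ Finset.Icc 1 k with m * e = k,
      ∑ lam : m.Partition with ∀ i ∈ lam.parts, i ≤ s,
        1 / centralizerWeight ((q : ℚ) ^ e) lam

/-- The number of `x ∈ GL_n(F)` with `x ^ M = 1`. -/
noncomputable def numRoots (F : Type*) [Field F] (M n : ℕ) : ℕ :=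
  Nat.card {x : Matrix.GeneralLinearGroup (Fin n) F // x ^ M = 1}

end RootsOfIdentity

/-! As `t` and `p ^ r` are coprime, a solution of `x ^ M = 1` is a product of commuting `y`, `z`
with `y ^ t = 1` and `z ^ (p ^ r) = 1`. In characteristic `p` the last equation says that `N = z -
1` satisfies `N ^ (p ^ r) = 0`. So `a_n` counts commuting pairs `(S, N)` with `S` killed by `X ^ t -
1` (`numRoots_eq_card_jordanPairs`).

Weighted by `1 / |GL_n|`, such pairs have a generating function that is multiplicative over coprime
factors `f`, `g` (`pairSeries_mul`), because `V = ker f(S) ⊕ ker g(S)` and `N` respects the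
splitting. The separable polynomial `X ^ t - 1` is the product of the cyclotomic polynomials for `d
∣ t`, each of which splits into `φ(d) / e(d)` distinct irreducibles of degree `e(d)`. For an
irreducible `φ` of degree `e`, an `S` with `φ(S) = 0` is a vector space structure over `K =
F[X]/(φ)`, and `N` is `K`-linear. What remains is to count the `N` with `N ^ s = 0` over a field
with `Q = q ^ e` elements (`card_jordanPairs_irreducible`).

This count needs no Jordan form. Factor `N = ι ∘ π` through a space of dimension `rank N`; then `N ^
(s + 1) = 0` iff `(π ∘ ι) ^ s = 0`, which gives a recursion in `s` refined by `dim ker N`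
(`nilCount_succ`). Passing from `N` to `π ∘ ι` mirrors deleting the first column of a partition, and
the partition sums satisfy the same recursion (`partitionSum_succ`). -/

namespace RootsOfIdentity

open Module Polynomial

/-! ### Double counting and the multiplicative Jordan decomposition -/

section Preliminaries

/-- Double counting: a relation between two finite types all of whose fibres over the first type
have `m` elements and all of whose fibres over the second have `n` elements. -/
theorem card_mul_eq_card_mul_of_fibers {α β : Type*} [Finite α] [Finite β] (R : α → β → Prop)
    {m n : ℕ} (hα : ∀ a, Nat.card {b // R a b} = m) (hβ : ∀ b, Nat.card {a // R a b} = n) :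
    Nat.card α * m = Nat.card β * n := by
  have := Fintype.ofFinite α
  have := Fintype.ofFinite β
  have e : (Σ a, {b // R a b}) ≃ (Σ b, {a // R a b}) :=
    { toFun := fun x => ⟨x.2.1, x.1, x.2.2⟩
      invFun := fun x => ⟨x.2.1, x.1, x.2.2⟩
      left_inv := fun _ => rfl
      right_inv := fun _ => rfl }
  have h := Nat.card_congr e
  rw [Nat.card_sigma, Nat.card_sigma] at h
  simpa [hα, hβ, Nat.card_eq_fintype_card] using h

/-- The set of linear equivalences between two spaces of dimension `n` has as many elements as
`GL_n`. -/
theorem card_linearEquiv {K V W : Type*} [Field K] [AddCommGroup V] [Module K V]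
    [AddCommGroup W] [Module K W] [FiniteDimensional K V] [FiniteDimensional K W] {n : ℕ}
    (hV : finrank K V = n) (hW : finrank K W = n) :
    Nat.card (V ≃ₗ[K] W) = Nat.card (GL (Fin n) K) := by
  have eV : V ≃ₗ[K] (Fin n → K) := LinearEquiv.ofFinrankEq _ _ (by simpa using hV)
  have eW : W ≃ₗ[K] (Fin n → K) := LinearEquiv.ofFinrankEq _ _ (by simpa using hW)
  have e1 : (V ≃ₗ[K] W) ≃ ((Fin n → K) ≃ₗ[K] (Fin n → K)) :=
    { toFun := fun g => eV.symm.trans (g.trans eW)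
      invFun := fun g => eV.trans (g.trans eW.symm)
      left_inv := fun g => by ext; simp
      right_inv := fun g => by ext; simp }
  rw [Nat.card_congr e1]
  exact Nat.card_congr ((LinearMap.GeneralLinearGroup.generalLinearEquiv K (Fin n → K)).symm.trans
    Matrix.GeneralLinearGroup.toLin.symm).toEquiv

theorem finite_end (K V : Type*) [Field K] [Finite K] [AddCommGroup V] [Module K V]
    [FiniteDimensional K V] : Finite (End K V) :=
  have := Module.finite_of_finite K (M := End K V)
  this

/-- The commuting pairs `(S, N)` of endomorphisms of `V` with `f(S) = 0` and `N ^ s = 0`. -/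
def jordanPairs {F : Type*} [Field F] (f : F[X]) (s : ℕ) (V : Type*) [AddCommGroup V]
    [Module F V] : Set (End F V × End F V) :=
  {x | Commute x.1 x.2 ∧ aeval x.1 f = 0 ∧ x.2 ^ s = 0}

/-- In a monoid, the solutions of `x ^ (a * b) = 1` with `a`, `b` coprime correspond to the
commuting pairs of solutions of `y ^ a = 1` and `z ^ b = 1`. -/
theorem card_pow_mul_eq_one {G : Type*} [Monoid G] {a b : ℕ} (hab : a.Coprime b) :
    Nat.card {x : G // x ^ (a * b) = 1} =
      Nat.card {y : G × G // Commute y.1 y.2 ∧ y.1 ^ a = 1 ∧ y.2 ^ b = 1} := by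
  -- The exponents are the idempotents of `ℤ/ab = ℤ/a × ℤ/b`: `x ^ u` is the part of `x` killed by
  -- `a`, `x ^ v` the part killed by `b`.
  obtain ⟨u, hu1, hu2⟩ := Nat.chineseRemainder hab 1 0
  obtain ⟨v, hv1, hv2⟩ := Nat.chineseRemainder hab 0 1
  have key : ∀ {x : G} {n i j : ℕ}, x ^ n = 1 → i ≡ j [MOD n] → x ^ i = x ^ j := by
    intro x n i j hx hij
    have h : i % orderOf x = j % orderOf x := hij.of_dvd (orderOf_dvd_of_pow_eq_one hx)
    rw [← pow_mod_orderOf, h, pow_mod_orderOf]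
  have huv : u + v ≡ 1 [MOD a * b] :=
    (Nat.modEq_and_modEq_iff_modEq_mul hab).1 ⟨hu1.add hv1, by simpa using hu2.add hv2⟩
  have hub : b ∣ u := (Nat.modEq_zero_iff_dvd).1 hu2
  have hva : a ∣ v := (Nat.modEq_zero_iff_dvd).1 hv1
  refine Nat.card_congr
    { toFun := fun x => ⟨(x.1 ^ u, x.1 ^ v), (Commute.refl x.1).pow_pow u v, ?_, ?_⟩
      invFun := fun y => ⟨y.1.1 * y.1.2, ?_⟩
      left_inv := ?_
      right_inv := ?_ }
  · obtain ⟨c, rfl⟩ := hub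
    rw [← pow_mul, show b * c * a = a * b * c by ring, pow_mul, x.2, one_pow]
  · obtain ⟨c, rfl⟩ := hva
    rw [← pow_mul, show a * c * b = a * b * c by ring, pow_mul, x.2, one_pow]
  · rw [y.2.1.mul_pow, pow_mul, y.2.2.1, one_pow, mul_comm a b, pow_mul, y.2.2.2, one_pow, one_mul]
  · rintro ⟨x, hx⟩
    ext
    change x ^ u * x ^ v = x
    rw [← pow_add, key hx huv, pow_one]
  · rintro ⟨⟨y, z⟩, hc, hy, hz⟩
    simp only at hc hy hz
    ext
    · change (y * z) ^ u = y
      rw [hc.mul_pow, key hy hu1, key hz hu2, pow_zero, pow_one, mul_one]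
    · change (y * z) ^ v = z
      rw [hc.mul_pow, key hy hv1, key hz hv2, pow_zero, pow_one, one_mul]

/-- The multiplicative Jordan decomposition counts the `M`-th roots of the identity. -/
theorem numRoots_eq_card_jordanPairs (F : Type*) [Field F] (p : ℕ) [Fact p.Prime] [CharP F p]
    {t : ℕ} (r : ℕ) (ht : ¬ p ∣ t) (n : ℕ) :
    numRoots F (t * p ^ r) n =
      Nat.card (jordanPairs (X ^ t - 1 : F[X]) (p ^ r) (Fin n → F)) := by
  have hp : p.Prime := Fact.out
  have hM : t * p ^ r ≠ 0 :=
    mul_ne_zero (by rintro rfl; exact ht (dvd_zero p)) (pow_ne_zero _ hp.ne_zero)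
  have hcop : t.Coprime (p ^ r) :=
    ((Nat.Prime.coprime_iff_not_dvd hp).2 ht).symm.pow_right r
  have e1 : {x : GL (Fin n) F // x ^ (t * p ^ r) = 1} ≃
      {x : Matrix (Fin n) (Fin n) F // x ^ (t * p ^ r) = 1} :=
    { toFun := fun x => ⟨x.1.1, by rw [← Units.val_pow_eq_pow_val, x.2, Units.val_one]⟩
      invFun := fun x => ⟨Units.ofPowEqOne x.1 _ x.2 hM, Units.pow_ofPowEqOne _ _⟩
      left_inv := fun x => by ext; rfl
      right_inv := fun x => by ext; rfl }
  have e2 : {x : Matrix (Fin n) (Fin n) F // x ^ (t * p ^ r) = 1} ≃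
      {x : End F (Fin n → F) // x ^ (t * p ^ r) = 1} :=
    (Matrix.toLinAlgEquiv' (R := F) (n := Fin n)).toEquiv.subtypeEquiv fun x => by
      change _ ↔ (Matrix.toLinAlgEquiv' x) ^ _ = 1
      rw [← map_pow, EmbeddingLike.map_eq_one_iff]
  rw [numRoots, Nat.card_congr e1, Nat.card_congr e2, card_pow_mul_eq_one hcop]
  have hchar : ∀ z : End F (Fin n → F), (z - 1) ^ p ^ r = z ^ p ^ r - 1 := by
    intro z
    -- For `n = 0` the endomorphism ring is trivial and does not have characteristic `p`.
    rcases isEmpty_or_nonempty (Fin n) with h | h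
    · exact Subsingleton.elim _ _
    · have : CharP (End F (Fin n → F)) p :=
        charP_of_injective_algebraMap (algebraMap F (End F (Fin n → F))).injective p
      rw [sub_pow_char_pow_of_commute p r (Commute.one_right z), one_pow]
  -- The unipotent factor `z` becomes the nilpotent `z - 1`.
  refine Nat.card_congr (((Equiv.refl _).prodCongr (Equiv.subRight 1)).subtypeEquiv ?_)
  rintro ⟨y, z⟩
  simp only [jordanPairs, Set.mem_ofPred_eq, Equiv.prodCongr_apply, Prod.map_apply,
    Equiv.refl_apply, Equiv.subRight_apply, hchar, map_sub, map_pow, aeval_X, map_one, sub_eq_zero]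
  have : Commute y (z - 1) ↔ Commute y z :=
    ⟨fun h => by simpa using h.add_right (Commute.one_right y),
      fun h => h.sub_right (Commute.one_right y)⟩
  rw [this]

end Preliminaries

/-! ### Multiplicativity over coprime polynomials -/

section CoprimeFactors

theorem commute_aeval {F A : Type*} [CommSemiring F] [Semiring A] [Algebra F A] {S T : A}
    (h : Commute S T) (f : F[X]) : Commute (aeval S f) T := by
  induction f using Polynomial.induction_on' with
  | add p q hp hq => simpa using hp.add_left hq
  | monomial n a =>
    rw [aeval_monomial]
    exact (show Commute _ T from Algebra.commutes a T).mul_left (h.pow_left n)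

section Frames

variable {F V A B : Type*} [Field F] [AddCommGroup V] [Module F V] [AddCommGroup A] [Module F A]
  [AddCommGroup B] [Module F B]

/-- `e : V ≃ A × B` maps the subspace `U` into `A` and the subspace `W` into `B`. -/
def IsFrame (U W : Submodule F V) (e : V ≃ₗ[F] A × B) : Prop :=
  (∀ u ∈ U, (e u).2 = 0) ∧ ∀ w ∈ W, (e w).1 = 0

theorem IsFrame.fst_injective {U W : Submodule F V} {e : V ≃ₗ[F] A × B} (he : IsFrame U W e) :
    Function.Injective (LinearMap.fst F A B ∘ₗ e.toLinearMap ∘ₗ U.subtype) := by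
  rw [← LinearMap.ker_eq_bot, LinearMap.ker_eq_bot']
  rintro ⟨u, hu⟩ h
  have h1 : (e u).1 = 0 := h
  have : e u = 0 := Prod.ext h1 (he.1 u hu)
  simpa using this

theorem IsFrame.snd_injective {U W : Submodule F V} {e : V ≃ₗ[F] A × B} (he : IsFrame U W e) :
    Function.Injective (LinearMap.snd F A B ∘ₗ e.toLinearMap ∘ₗ W.subtype) := by
  rw [← LinearMap.ker_eq_bot, LinearMap.ker_eq_bot']
  rintro ⟨w, hw⟩ h
  have h1 : (e w).2 = 0 := h
  have : e w = 0 := Prod.ext (he.2 w hw) h1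
  simpa using this

theorem IsFrame.mem_left {U W : Submodule F V} (hUW : IsCompl U W) {e : V ≃ₗ[F] A × B}
    (he : IsFrame U W e) {v : V} (hv : (e v).2 = 0) : v ∈ U := by
  obtain ⟨u, hu, w, hw, rfl⟩ := Submodule.mem_sup.1 (hUW.sup_eq_top ▸ Submodule.mem_top : v ∈ U ⊔ W)
  have h2 : (e w).2 = 0 := by simpa [he.1 u hu] using hv
  have : e w = 0 := Prod.ext (he.2 w hw) h2
  have : w = 0 := by simpa using this
  simpa [this] using hu

theorem IsFrame.mem_right {U W : Submodule F V} (hUW : IsCompl U W) {e : V ≃ₗ[F] A × B}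
    (he : IsFrame U W e) {v : V} (hv : (e v).1 = 0) : v ∈ W := by
  obtain ⟨u, hu, w, hw, rfl⟩ := Submodule.mem_sup.1 (hUW.sup_eq_top ▸ Submodule.mem_top : v ∈ U ⊔ W)
  have h2 : (e u).1 = 0 := by simpa [he.2 w hw] using hv
  have : e u = 0 := Prod.ext h2 (he.1 u hu)
  have : u = 0 := by simpa using this
  simpa [this] using hw

variable [FiniteDimensional F V] [FiniteDimensional F A] [FiniteDimensional F B]

theorem IsFrame.finrank_eq {U W : Submodule F V} (hUW : IsCompl U W) {e : V ≃ₗ[F] A × B}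
    (he : IsFrame U W e) : finrank F U = finrank F A ∧ finrank F W = finrank F B := by
  -- Each subspace embeds in its factor and the total dimensions agree, so both inequalities are
  -- equalities.
  have h1 := LinearMap.finrank_le_finrank_of_injective he.fst_injective
  have h2 := LinearMap.finrank_le_finrank_of_injective he.snd_injective
  have h3 := Submodule.finrank_add_eq_of_isCompl hUW
  have h4 := e.finrank_eq
  rw [finrank_prod] at h4
  omega

/-- The number of frames adapted to a decomposition. -/
theorem card_isFrame {U W : Submodule F V} (hUW : IsCompl U W) {k l : ℕ}
    (hU : finrank F U = k) (hW : finrank F W = l) (hA : finrank F A = k) (hB : finrank F B = l) :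
    Nat.card {e : V ≃ₗ[F] A × B // IsFrame U W e} =
      Nat.card (GL (Fin k) F) * Nat.card (GL (Fin l) F) := by
  rw [← card_linearEquiv hU hA, ← card_linearEquiv hW hB, ← Nat.card_prod]
  symm
  have hl : ∀ (e : (U ≃ₗ[F] A) × (W ≃ₗ[F] B)) (u : U),
      ((Submodule.prodEquivOfIsCompl U W hUW).symm.trans (e.1.prodCongr e.2)) u = (e.1 u, 0) := by
    intro e u; simp
  have hr : ∀ (e : (U ≃ₗ[F] A) × (W ≃ₗ[F] B)) (w : W),
      ((Submodule.prodEquivOfIsCompl U W hUW).symm.trans (e.1.prodCongr e.2)) w = (0, e.2 w) := by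
    intro e u; simp
  refine Nat.card_eq_of_bijective (fun e : (U ≃ₗ[F] A) × (W ≃ₗ[F] B) =>
    ⟨(Submodule.prodEquivOfIsCompl U W hUW).symm.trans (e.1.prodCongr e.2),
      fun u hu => by rw [hl e ⟨u, hu⟩], fun w hw => by rw [hr e ⟨w, hw⟩]⟩) ⟨?_, ?_⟩
  · intro e e' h
    have h' := Subtype.ext_iff.1 h
    simp only at h'
    refine Prod.ext (LinearEquiv.ext fun u => ?_) (LinearEquiv.ext fun w => ?_)
    · have := hl e u
      rw [h', hl e' u] at this
      exact (Prod.ext_iff.1 this).1.symm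
    · have := hr e w
      rw [h', hr e' w] at this
      exact (Prod.ext_iff.1 this).2.symm
  · rintro ⟨e, he⟩
    refine ⟨(LinearMap.linearEquivOfInjective _ he.fst_injective (hU.trans hA.symm),
      LinearMap.linearEquivOfInjective _ he.snd_injective (hW.trans hB.symm)), ?_⟩
    refine Subtype.ext (LinearEquiv.ext fun v => ?_)
    obtain ⟨u, hu, w, hw, rfl⟩ :=
      Submodule.mem_sup.1 (hUW.sup_eq_top ▸ Submodule.mem_top : v ∈ U ⊔ W)
    refine (map_add _ u w).trans ((congrArg₂ (· + ·) (hl _ ⟨u, hu⟩) (hr _ ⟨w, hw⟩)).trans ?_)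
    ext
    · simp [LinearMap.linearEquivOfInjective_apply, he.2 w hw]
    · simp [LinearMap.linearEquivOfInjective_apply, he.1 u hu]

end Frames

section Blocks

variable {F V A B : Type*} [Field F] [AddCommGroup V] [Module F V] [AddCommGroup A] [Module F A]
  [AddCommGroup B] [Module F B]

/-- The block diagonal endomorphisms of `V` with respect to `e : V ≃ A × B`. -/
noncomputable def blockDiag (e : V ≃ₗ[F] A × B) : End F A × End F B →ₐ[F] End F V :=
  (e.symm.conjAlgEquiv F : End F (A × B) →ₐ[F] End F V).comp (LinearMap.prodMapAlgHom F A B)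

theorem apply_blockDiag (e : V ≃ₗ[F] A × B) (P : End F A × End F B) (v : V) :
    e (blockDiag e P v) = (P.1 (e v).1, P.2 (e v).2) := by
  change e (e.symm (LinearMap.prodMap P.1 P.2 (e v))) = _
  simp [LinearMap.prodMap_apply]

theorem blockDiag_injective (e : V ≃ₗ[F] A × B) : Function.Injective (blockDiag e) := by
  intro P P' h
  refine Prod.ext (LinearMap.ext fun a => ?_) (LinearMap.ext fun b => ?_)
  · have h1 := apply_blockDiag e P (e.symm (a, 0))
    rw [h, apply_blockDiag] at h1
    simpa using (Prod.ext_iff.1 h1).1.symm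
  · have h1 := apply_blockDiag e P (e.symm (0, b))
    rw [h, apply_blockDiag] at h1
    simpa using (Prod.ext_iff.1 h1).2.symm

theorem exists_blockDiag_eq (e : V ≃ₗ[F] A × B) (S : End F V)
    (h2 : ∀ v, (e v).2 = 0 → (e (S v)).2 = 0) (h1 : ∀ v, (e v).1 = 0 → (e (S v)).1 = 0) :
    ∃ P, blockDiag e P = S := by
  refine ⟨(LinearMap.fst F A B ∘ₗ e.toLinearMap ∘ₗ S ∘ₗ e.symm.toLinearMap ∘ₗ LinearMap.inl F A B,
    LinearMap.snd F A B ∘ₗ e.toLinearMap ∘ₗ S ∘ₗ e.symm.toLinearMap ∘ₗ LinearMap.inr F A B), ?_⟩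
  refine LinearMap.ext fun v => e.injective ?_
  rw [apply_blockDiag]
  obtain ⟨⟨a, b⟩, rfl⟩ := e.symm.surjective v
  have hab : e.symm (a, b) = e.symm (a, 0) + e.symm (0, b) := by rw [← map_add]; simp
  have ha := h2 (e.symm (a, 0)) (by simp)
  have hb := h1 (e.symm (0, b)) (by simp)
  ext
  · rw [hab]; simp [hb]
  · rw [hab]; simp [ha]

theorem isCompl_ker_aeval {f g : F[X]} (hfg : IsCoprime f g) {S : End F V}
    (hS : aeval S (f * g) = 0) : IsCompl (LinearMap.ker (aeval S f)) (LinearMap.ker (aeval S g)) :=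
  ⟨disjoint_ker_aeval_of_isCoprime S hfg, codisjoint_iff.2 <| by
    rw [sup_ker_aeval_eq_ker_aeval_mul_of_coprime S hfg, hS, LinearMap.ker_zero]⟩

variable [FiniteDimensional F V] [FiniteDimensional F A] [FiniteDimensional F B]

/-- For a fixed frame `e`, the pairs adapted to it are exactly the block diagonal ones, with one
block killed by `f` and the other by `g`. Coprimality makes `f` injective on the second block and
`g` on the first, so the kernels are the two summands. -/
theorem card_jordanPairs_isFrame {f g : F[X]} (hfg : IsCoprime f g) (s : ℕ) {k : ℕ}
    (hA : finrank F A = k) (e : V ≃ₗ[F] A × B) :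
    Nat.card {x : {x : jordanPairs (f * g) s V // finrank F (LinearMap.ker (aeval x.1.1 f)) = k} //
        IsFrame (LinearMap.ker (aeval x.1.1.1 f)) (LinearMap.ker (aeval x.1.1.1 g)) e} =
      Nat.card (jordanPairs f s A) * Nat.card (jordanPairs g s B) := by
  rw [← Nat.card_prod]
  symm
  have key : ∀ (x : jordanPairs f s A) (y : jordanPairs g s B),
      (blockDiag e (x.1.1, y.1.1), blockDiag e (x.1.2, y.1.2)) ∈ jordanPairs (f * g) s V := by
    rintro ⟨x, hx1, hx2, hx3⟩ ⟨y, hy1, hy2, hy3⟩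
    refine ⟨(Prod.commute_iff.2 ⟨hx1, hy1⟩).map (blockDiag e), ?_, ?_⟩
    · change aeval (blockDiag e (x.1, y.1)) (f * g) = 0
      rw [aeval_algHom_apply, aeval_prod_apply, map_mul, map_mul, hx2, hy2, zero_mul, mul_zero]
      exact map_zero _
    · change blockDiag e (x.2, y.2) ^ s = 0
      rw [← map_pow, Prod.pow_mk, hx3, hy3]
      exact map_zero _
  have hframe : ∀ (x : jordanPairs f s A) (y : jordanPairs g s B),
      IsFrame (LinearMap.ker (aeval (blockDiag e (x.1.1, y.1.1)) f))
        (LinearMap.ker (aeval (blockDiag e (x.1.1, y.1.1)) g)) e := by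
    rintro ⟨x, hx1, hx2, hx3⟩ ⟨y, hy1, hy2, hy3⟩
    constructor
    · intro v hv
      rw [LinearMap.mem_ker, aeval_algHom_apply, aeval_prod_apply] at hv
      have h := apply_blockDiag e (aeval x.1 f, aeval y.1 f) v
      rw [hv, map_zero] at h
      have h2 : (e v).2 ∈ LinearMap.ker (aeval y.1 f) := (Prod.ext_iff.1 h).2.symm
      exact Submodule.disjoint_def.1 (disjoint_ker_aeval_of_isCoprime y.1 hfg) _ h2 (by simp [hy2])
    · intro v hv
      rw [LinearMap.mem_ker, aeval_algHom_apply, aeval_prod_apply] at hv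
      have h := apply_blockDiag e (aeval x.1 g, aeval y.1 g) v
      rw [hv, map_zero] at h
      have h2 : (e v).1 ∈ LinearMap.ker (aeval x.1 g) := (Prod.ext_iff.1 h).1.symm
      exact Submodule.disjoint_def.1 (disjoint_ker_aeval_of_isCoprime x.1 hfg) _ (by simp [hx2]) h2
  refine Nat.card_eq_of_bijective (fun x : jordanPairs f s A × jordanPairs g s B =>
    ⟨⟨⟨_, key x.1 x.2⟩, ?_⟩, hframe x.1 x.2⟩) ⟨?_, ?_⟩
  · exact ((hframe x.1 x.2).finrank_eq (isCompl_ker_aeval hfg (key x.1 x.2).2.1)).1.trans hA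
  · rintro ⟨⟨x, hx⟩, ⟨y, hy⟩⟩ ⟨⟨x', hx'⟩, ⟨y', hy'⟩⟩ h
    simp only [Subtype.mk.injEq, Prod.mk.injEq] at h
    have h1 := Prod.ext_iff.1 (blockDiag_injective e h.1)
    have h2 := Prod.ext_iff.1 (blockDiag_injective e h.2)
    simp only at h1 h2
    simp only [Prod.mk.injEq, Subtype.mk.injEq]
    exact ⟨Prod.ext h1.1 h2.1, Prod.ext h1.2 h2.2⟩
  · rintro ⟨⟨⟨⟨S, N⟩, hSN, hS, hN⟩, hk⟩, he⟩
    simp only at hSN hS hN hk he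
    have hc := isCompl_ker_aeval hfg hS
    have inv : ∀ (T : End F V) (f : F[X]), Commute S T → ∀ v, aeval S f v = 0 →
        aeval S f (T v) = 0 := by
      intro T f hT v hv
      rw [← Module.End.mul_apply, (commute_aeval hT f).eq, Module.End.mul_apply, hv, map_zero]
    -- Whatever commutes with `S` preserves both kernels, hence is block diagonal; this applies to
    -- `S` and to `N`.
    have ex : ∀ T : End F V, Commute S T → ∃ P, blockDiag e P = T := fun T hT =>
      exists_blockDiag_eq e T (fun v hv => he.1 _ (inv T f hT v (he.mem_left hc hv)))
        (fun v hv => he.2 _ (inv T g hT v (he.mem_right hc hv)))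
    obtain ⟨⟨S1, S2⟩, rfl⟩ := ex S (Commute.refl S)
    obtain ⟨⟨N1, N2⟩, rfl⟩ := ex N hSN
    have hcomm : Commute S1 N1 ∧ Commute S2 N2 :=
      (Prod.commute_iff (x := (S1, S2)) (y := (N1, N2))).1 <| blockDiag_injective e <| by
        rw [map_mul, map_mul, hSN.eq]
    have hnil : N1 ^ s = 0 ∧ N2 ^ s = 0 := by
      rw [← map_pow, ← map_zero (blockDiag e)] at hN
      exact Prod.ext_iff.1 (blockDiag_injective e hN)
    refine ⟨(⟨(S1, N1), hcomm.1, ?_, hnil.1⟩, ⟨(S2, N2), hcomm.2, ?_, hnil.2⟩), rfl⟩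
    · refine LinearMap.ext fun a => ?_
      have h0 : aeval (blockDiag e (S1, S2)) f (e.symm (a, 0)) = 0 := he.mem_left hc (by simp)
      rw [aeval_algHom_apply, aeval_prod_apply] at h0
      have h := apply_blockDiag e (aeval S1 f, aeval S2 f) (e.symm (a, 0))
      rw [h0] at h
      simpa using (Prod.ext_iff.1 h).1.symm
    · refine LinearMap.ext fun b => ?_
      have h0 : aeval (blockDiag e (S1, S2)) g (e.symm (0, b)) = 0 := he.mem_right hc (by simp)
      rw [aeval_algHom_apply, aeval_prod_apply] at h0
      have h := apply_blockDiag e (aeval S1 g, aeval S2 g) (e.symm (0, b))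
      rw [h0] at h
      simpa using (Prod.ext_iff.1 h).2.symm

end Blocks

variable {F : Type*} [Field F] [Finite F]

/-- Double counting of a pair together with a frame adapted to its kernel decomposition. -/
theorem card_jordanPairs_mul_aux {f g : F[X]} (hfg : IsCoprime f g) (s k l : ℕ) :
    Nat.card {x : jordanPairs (f * g) s (Fin (k + l) → F) //
        finrank F (LinearMap.ker (aeval x.1.1 f)) = k} *
      (Nat.card (GL (Fin k) F) * Nat.card (GL (Fin l) F)) =
    Nat.card (GL (Fin (k + l)) F) *
      (Nat.card (jordanPairs f s (Fin k → F)) * Nat.card (jordanPairs g s (Fin l → F))) := by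
  have := finite_end F (Fin (k + l) → F)
  have hfin : Finite ((Fin (k + l) → F) ≃ₗ[F] (Fin k → F) × (Fin l → F)) :=
    Finite.of_injective _ DFunLike.coe_injective
  rw [← card_linearEquiv (V := Fin (k + l) → F) (W := (Fin k → F) × (Fin l → F)) (n := k + l)
    (by simp) (by simp)]
  refine card_mul_eq_card_mul_of_fibers
    (fun (x : {x : jordanPairs (f * g) s (Fin (k + l) → F) //
        finrank F (LinearMap.ker (aeval x.1.1 f)) = k}) e =>
      IsFrame (LinearMap.ker (aeval x.1.1.1 f)) (LinearMap.ker (aeval x.1.1.1 g)) e)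
    (fun x => ?_) (fun e => card_jordanPairs_isFrame hfg s (finrank_fin_fun F) e)
  have hc := isCompl_ker_aeval hfg x.1.2.2.1
  refine card_isFrame hc x.2 ?_ (by simp) (by simp)
  have h1 := Submodule.finrank_add_eq_of_isCompl hc
  rw [x.2, finrank_fin_fun] at h1
  omega

/-- The generating function of the numbers of commuting pairs `(S, N)` with `f(S) = 0`,
`N ^ s = 0`, weighted by `1 / |GL_n|`. -/
noncomputable def pairSeries (f : F[X]) (s : ℕ) : PowerSeries ℚ :=
  PowerSeries.mk fun n =>
    (Nat.card (jordanPairs f s (Fin n → F)) : ℚ) / Nat.card (GL (Fin n) F)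

theorem card_GL_ne_zero (n : ℕ) : (Nat.card (GL (Fin n) F) : ℚ) ≠ 0 := by
  have : Finite (GL (Fin n) F) := inferInstance
  exact_mod_cast Nat.card_pos.ne'

theorem pairSeries_mul {f g : F[X]} (hfg : IsCoprime f g) (s : ℕ) :
    pairSeries (f * g) s = pairSeries f s * pairSeries g s := by
  ext n
  rw [PowerSeries.coeff_mul]
  simp only [pairSeries, PowerSeries.coeff_mk]
  have := finite_end F (Fin n → F)
  -- Sorting the pairs by the dimensions of the two kernels produces the Cauchy product.
  let d : jordanPairs (f * g) s (Fin n → F) → Finset.HasAntidiagonal.antidiagonal n := fun x =>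
    ⟨(finrank F (LinearMap.ker (aeval x.1.1 f)),
      n - finrank F (LinearMap.ker (aeval x.1.1 f))), by
        have := Submodule.finrank_le (LinearMap.ker (aeval x.1.1 f))
        rw [finrank_fin_fun] at this
        rw [Finset.HasAntidiagonal.mem_antidiagonal]
        exact Nat.add_sub_cancel' this⟩
  have hd : ∀ kl, Nat.card {x // d x = kl} = Nat.card {x : jordanPairs (f * g) s (Fin n → F) //
        finrank F (LinearMap.ker (aeval x.1.1 f)) = kl.1.1} := by
    rintro ⟨⟨k, l⟩, hkl⟩
    refine Nat.card_congr (Equiv.subtypeEquivRight fun x => ?_)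
    have := Finset.HasAntidiagonal.mem_antidiagonal.1 hkl
    simp only [d, Subtype.mk.injEq, Prod.mk.injEq]
    simp only at this
    omega
  rw [← Nat.card_congr (Equiv.sigmaFiberEquiv d), Nat.card_sigma, Finset.univ_eq_attach,
    Nat.cast_sum, Finset.sum_div]
  simp only [hd]
  rw [Finset.sum_attach (Finset.HasAntidiagonal.antidiagonal n) (fun kl =>
    (Nat.card {x : jordanPairs (f * g) s (Fin n → F) //
        finrank F (LinearMap.ker (aeval x.1.1 f)) = kl.1} : ℚ) / Nat.card (GL (Fin n) F))]
  refine Finset.sum_congr rfl ?_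
  rintro ⟨k, l⟩ hkl
  obtain rfl := Finset.HasAntidiagonal.mem_antidiagonal.1 hkl
  have h := card_jordanPairs_mul_aux hfg s k l
  have h' := congrArg (Nat.cast : ℕ → ℚ) h
  push_cast at h'
  have := card_GL_ne_zero (F := F) k
  have := card_GL_ne_zero (F := F) l
  have := card_GL_ne_zero (F := F) (k + l)
  field_simp
  linear_combination h'

end CoprimeFactors

/-! ### Irreducible polynomials: passage to the extension field -/

section IrreducibleFactor

theorem semiconj_pow {F K V W : Type*} [Semiring F] [Semiring K] [AddCommMonoid V] [Module F V]
    [AddCommMonoid W] [Module K W] {g : V → W} {N : End F V} {N' : End K W}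
    (h : ∀ v, g (N v) = N' (g v)) (s : ℕ) (v : V) : g ((N ^ s) v) = (N' ^ s) (g v) := by
  rw [Module.End.coe_pow, Module.End.coe_pow]
  exact (show Function.Semiconj g N N' from h).iterate_right s v

section FieldExtension

variable {F : Type*} [Field F] {φ : F[X]} [Fact (Irreducible φ)]

/-- An endomorphism `S` with `φ(S) = 0` makes `V` a vector space over `F[X]/(φ)`. -/
theorem exists_module_adjoinRoot {V : Type*} [AddCommGroup V] [Module F V] {S : End F V}
    (hS : aeval S φ = 0) : ∃ _ : Module (AdjoinRoot φ) V, IsScalarTower F (AdjoinRoot φ) V ∧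
      ∀ (p : F[X]) (v : V), AdjoinRoot.mk φ p • v = aeval S p v := by
  let ψ : AdjoinRoot φ →+* End F V := Ideal.Quotient.lift (Ideal.span {φ})
    (aeval S : F[X] →ₐ[F] End F V).toRingHom (by
      intro a ha
      obtain ⟨b, rfl⟩ := Ideal.mem_span_singleton'.1 ha
      change aeval S (b * φ) = 0
      rw [map_mul, hS, mul_zero])
  let _ : Module (AdjoinRoot φ) V := Module.compHom V ψ
  have hsmul : ∀ (p : F[X]) (v : V), AdjoinRoot.mk φ p • v = aeval S p v := fun p v => rfl
  refine ⟨inferInstance, IsScalarTower.of_algebraMap_smul fun c v => ?_, hsmul⟩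
  rw [AdjoinRoot.algebraMap_eq]
  change AdjoinRoot.mk φ (C c) • v = _
  rw [hsmul, aeval_C, Module.algebraMap_end_apply]

theorem finrank_adjoinRoot : finrank F (AdjoinRoot φ) = φ.natDegree := by
  have h : Irreducible φ := Fact.out
  rw [(AdjoinRoot.powerBasis h.ne_zero).finrank, AdjoinRoot.powerBasis_dim]

theorem finiteDimensional_adjoinRoot : FiniteDimensional F (AdjoinRoot φ) :=
  (AdjoinRoot.powerBasis (Fact.out : Irreducible φ).ne_zero).finite

theorem natDegree_dvd_of_aeval_eq_zero {V : Type*} [AddCommGroup V] [Module F V]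
    {S : End F V} (hS : aeval S φ = 0) : φ.natDegree ∣ finrank F V := by
  obtain ⟨_, _, _⟩ := exists_module_adjoinRoot hS
  rw [← finrank_mul_finrank F (AdjoinRoot φ) V, finrank_adjoinRoot]
  exact dvd_mul_right _ _

/-- The map `g` carries the pair `(S, N)` to multiplication by the root of `φ` and to `N'`. -/
def Intertwines {V W : Type*} [AddCommGroup V] [Module F V] [AddCommGroup W] [Module F W]
    [Module (AdjoinRoot φ) W] (x : End F V × End F V)
    (y : (V ≃ₗ[F] W) × End (AdjoinRoot φ) W) : Prop :=
  (∀ v, y.1 (x.1 v) = AdjoinRoot.root φ • y.1 v) ∧ ∀ v, y.1 (x.2 v) = y.2 (y.1 v)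

variable {V W : Type*} [AddCommGroup V] [Module F V] [AddCommGroup W] [Module F W]
    [Module (AdjoinRoot φ) W] [IsScalarTower F (AdjoinRoot φ) W] {s : ℕ}

theorem Intertwines.map_aeval {x : End F V × End F V} {y : (V ≃ₗ[F] W) × End (AdjoinRoot φ) W}
    (h : Intertwines x y) (p : F[X]) (v : V) :
    y.1 (aeval x.1 p v) = AdjoinRoot.mk φ p • y.1 v := by
  induction p using Polynomial.induction_on' with
  | add p q hp hq => simp [hp, hq, add_smul]
  | monomial n a =>
    have h1 := semiconj_pow (N := x.1)
      (N' := Algebra.lsmul F F W (AdjoinRoot.root φ)) (g := y.1) h.1 n v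
    rw [← map_pow] at h1
    rw [aeval_monomial, Module.End.mul_apply, Module.algebraMap_end_apply, map_smul,
      ← C_mul_X_pow_eq_monomial, map_mul, map_pow (AdjoinRoot.mk φ), AdjoinRoot.mk_X,
      AdjoinRoot.mk_C, mul_smul, ← AdjoinRoot.algebraMap_eq, algebraMap_smul]
    exact congrArg (a • ·) h1

/-- The pair is forced: it is the transport of multiplication by the root and of `N'` back along
`g`. -/
theorem card_intertwines_left (y : (V ≃ₗ[F] W) × {N : End (AdjoinRoot φ) W // N ^ s = 0}) :
    Nat.card {x : jordanPairs φ s V // Intertwines x.1 (y.1, y.2.1)} = 1 := by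
  obtain ⟨g, N', hN'⟩ := y
  rw [Nat.card_eq_one_iff_exists]
  let S : End F V := g.symm.toLinearMap ∘ₗ Algebra.lsmul F F W (AdjoinRoot.root φ) ∘ₗ g.toLinearMap
  let N : End F V := g.symm.toLinearMap ∘ₗ N'.restrictScalars F ∘ₗ g.toLinearMap
  have hi : Intertwines (S, N) (g, N') := ⟨fun v => by simp [S], fun v => by simp [N]⟩
  refine ⟨⟨⟨(S, N), ?_, ?_, ?_⟩, hi⟩, ?_⟩
  · refine LinearMap.ext fun v => g.injective ?_
    simp only [Module.End.mul_apply]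
    rw [hi.1, hi.2, hi.2, hi.1, map_smul]
  · refine LinearMap.ext fun v => g.injective ?_
    rw [hi.map_aeval]
    simp
  · refine LinearMap.ext fun v => g.injective ?_
    rw [semiconj_pow (N := N) (N' := N') (g := g) hi.2, hN']
    simp
  · rintro ⟨⟨⟨S1, N1⟩, h1⟩, h2⟩
    refine Subtype.ext (Subtype.ext (Prod.ext ?_ ?_))
    · exact LinearMap.ext fun v => g.injective ((h2.1 v).trans (hi.1 v).symm)
    · exact LinearMap.ext fun v => g.injective ((h2.2 v).trans (hi.2 v).symm)

variable [FiniteDimensional F V] [FiniteDimensional F W]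

/-- Once `S` has turned `V` into a space over the extension field, intertwining means that `g` is
linear over that field, and `N'` is then determined as the conjugate of `N` by `g`. -/
theorem card_intertwines_right {m : ℕ} (hV : finrank F V = φ.natDegree * m)
    (hW : finrank (AdjoinRoot φ) W = m) (x : jordanPairs φ s V) :
    Nat.card {y : (V ≃ₗ[F] W) × {N : End (AdjoinRoot φ) W // N ^ s = 0} //
      Intertwines x.1 (y.1, y.2.1)} = Nat.card (GL (Fin m) (AdjoinRoot φ)) := by
  obtain ⟨⟨S, N⟩, hSN, hS, hN⟩ := x
  simp only at hSN hS hN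
  obtain ⟨_, _, hsmul⟩ := exists_module_adjoinRoot hS
  have : FiniteDimensional (AdjoinRoot φ) V := FiniteDimensional.right F _ _
  have : FiniteDimensional (AdjoinRoot φ) W := FiniteDimensional.right F _ _
  have hV' : finrank (AdjoinRoot φ) V = m := by
    have h := finrank_mul_finrank F (AdjoinRoot φ) V
    rw [hV, finrank_adjoinRoot] at h
    exact Nat.eq_of_mul_eq_mul_left (Fact.out : Irreducible φ).natDegree_pos h
  rw [← card_linearEquiv hV' hW]
  have hroot : ∀ v, AdjoinRoot.root φ • v = S v := fun v => by
    rw [← AdjoinRoot.mk_X, hsmul, aeval_X]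
  -- Commuting with `S` is precisely linearity over the extension field.
  let N₁ : End (AdjoinRoot φ) V :=
    { N with
      map_smul' := by
        intro k v
        obtain ⟨p, rfl⟩ := AdjoinRoot.mk_surjective k
        change N (_ • v) = AdjoinRoot.mk φ p • N v
        rw [hsmul, hsmul]
        exact (LinearMap.congr_fun (commute_aeval hSN p).eq v).symm }
  have hN₁ : ∀ v, N₁ v = N v := fun v => rfl
  have hN₁s : N₁ ^ s = 0 := LinearMap.ext fun v => by
    have h := semiconj_pow (N := N) (N' := N₁) (g := id) (fun v => rfl) s v
    rw [hN] at h
    exact h.symm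
  symm
  refine Nat.card_eq_of_bijective (fun g : V ≃ₗ[AdjoinRoot φ] W =>
    ⟨(g.restrictScalars F, ⟨g.conjAlgEquiv (AdjoinRoot φ) N₁, ?_⟩), ?_, ?_⟩) ⟨?_, ?_⟩
  · rw [← map_pow, hN₁s, map_zero]
  · intro v
    simp [← hroot]
  · intro v
    simp [hN₁]
  · intro g g' h
    have h' := (Prod.ext_iff.1 (Subtype.ext_iff.1 h)).1
    exact LinearEquiv.ext fun v => LinearEquiv.congr_fun h' v
  · rintro ⟨⟨g, N', hN'⟩, hi⟩
    let g₁ : V ≃ₗ[AdjoinRoot φ] W :=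
      { g with
        map_smul' := by
          intro k v
          obtain ⟨p, rfl⟩ := AdjoinRoot.mk_surjective k
          change g (_ • v) = AdjoinRoot.mk φ p • g v
          rw [hsmul]
          exact hi.map_aeval p v }
    refine ⟨g₁, Subtype.ext (Prod.ext rfl (Subtype.ext (LinearMap.ext fun w => ?_)))⟩
    obtain ⟨v, rfl⟩ := g.surjective w
    refine Eq.trans ?_ (hi.2 v)
    have : g₁.symm (g v) = v := g₁.symm_apply_apply v
    rw [LinearEquiv.conjAlgEquiv_apply_apply, this]
    rfl

end FieldExtension

theorem coeff_pairSeries_irreducible_of_not_dvd {F : Type*} [Field F] (φ : F[X]) [Fact (Irreducible φ)] (s : ℕ) {n : ℕ}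
    (hn : ¬ φ.natDegree ∣ n) : PowerSeries.coeff n (pairSeries φ s) = 0 := by
  have : IsEmpty (jordanPairs φ s (Fin n → F)) := by
    refine ⟨fun x => hn ?_⟩
    simpa using natDegree_dvd_of_aeval_eq_zero x.2.2.1
  rw [pairSeries, PowerSeries.coeff_mk, Nat.card_of_isEmpty, Nat.cast_zero, zero_div]

variable {F : Type*} [Field F] [Finite F]

/-- Double counting of the relation `Intertwines`, with fibres of sizes `|GL_m(K)|` and `1`. -/
theorem card_jordanPairs_irreducible (φ : F[X]) [Fact (Irreducible φ)] (s m : ℕ) :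
    Nat.card (jordanPairs φ s (Fin (φ.natDegree * m) → F)) *
        Nat.card (GL (Fin m) (AdjoinRoot φ)) =
      Nat.card (GL (Fin (φ.natDegree * m)) F) *
        Nat.card {N : End (AdjoinRoot φ) (Fin m → AdjoinRoot φ) // N ^ s = 0} := by
  have := finiteDimensional_adjoinRoot (φ := φ)
  have : Finite (AdjoinRoot φ) := Module.finite_of_finite F
  have := finite_end F (Fin (φ.natDegree * m) → F)
  have := finite_end (AdjoinRoot φ) (Fin m → AdjoinRoot φ)
  have hfin : Finite ((Fin (φ.natDegree * m) → F) ≃ₗ[F] (Fin m → AdjoinRoot φ)) :=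
    Finite.of_injective _ DFunLike.coe_injective
  have hW : finrank F (Fin m → AdjoinRoot φ) = φ.natDegree * m := by
    rw [finrank_pi_fintype]
    simp [finrank_adjoinRoot, mul_comm]
  rw [← card_linearEquiv (finrank_fin_fun F) hW, ← Nat.card_prod (_ ≃ₗ[F] _)]
  rw [card_mul_eq_card_mul_of_fibers
    (fun (x : jordanPairs φ s (Fin (φ.natDegree * m) → F))
      (y : ((Fin (φ.natDegree * m) → F) ≃ₗ[F] (Fin m → AdjoinRoot φ)) ×
        {N : End (AdjoinRoot φ) (Fin m → AdjoinRoot φ) // N ^ s = 0}) =>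
      Intertwines x.1 (y.1, y.2.1))
    (fun x => card_intertwines_right (finrank_fin_fun F) (finrank_fin_fun _) x)
    (fun y => card_intertwines_left y), mul_one]

theorem coeff_pairSeries_irreducible (φ : F[X]) [Fact (Irreducible φ)] (s m : ℕ) :
    PowerSeries.coeff (φ.natDegree * m) (pairSeries φ s) =
      (Nat.card {N : End (AdjoinRoot φ) (Fin m → AdjoinRoot φ) // N ^ s = 0} : ℚ) /
        Nat.card (GL (Fin m) (AdjoinRoot φ)) := by
  have := finiteDimensional_adjoinRoot (φ := φ)
  have : Finite (AdjoinRoot φ) := Module.finite_of_finite F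
  have h := congrArg (Nat.cast : ℕ → ℚ) (card_jordanPairs_irreducible φ s m)
  push_cast at h
  have h1 := card_GL_ne_zero (F := F) (φ.natDegree * m)
  have h2 := card_GL_ne_zero (F := AdjoinRoot φ) m
  rw [pairSeries, PowerSeries.coeff_mk]
  rw [div_eq_div_iff h1 h2]
  linear_combination h

end IrreducibleFactor

/-! ### Recursion for nilpotent endomorphisms by rank factorization -/

section RankRecursion

/-- The number `∏_{i < r} (Q ^ m - Q ^ i)` of injective linear maps from an `r`-dimensional to an
`m`-dimensional space over the field with `Q` elements. -/
def injCount (Q r m : ℕ) : ℕ := ∏ i ∈ Finset.range r, (Q ^ m - Q ^ i)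

theorem injCount_eq_zero {Q r m : ℕ} (h : m < r) : injCount Q r m = 0 :=
  Finset.prod_eq_zero (Finset.mem_range.2 h) (Nat.sub_self _)

section Counting

variable {K V W : Type*} [Field K] [Finite K] [AddCommGroup V] [Module K V] [AddCommGroup W]
  [Module K W] [FiniteDimensional K V] [FiniteDimensional K W]

theorem card_injective {r m : ℕ} (hV : finrank K V = r) (hW : finrank K W = m) :
    Nat.card {f : V →ₗ[K] W // Function.Injective f} = injCount (Nat.card K) r m := by
  rcases lt_or_ge m r with h | h
  · rw [injCount_eq_zero h]
    have : IsEmpty {f : V →ₗ[K] W // Function.Injective f} :=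
      ⟨fun f => by
        have := LinearMap.finrank_le_finrank_of_injective f.2
        omega⟩
    exact Nat.card_of_isEmpty
  · have := Fintype.ofFinite K
    have : Finite W := Module.finite_of_finite K
    let b : Basis (Fin r) K V := finBasisOfFinrankEq K V hV
    have e : {v : Fin r → W // LinearIndependent K v} ≃
        {f : V →ₗ[K] W // Function.Injective f} :=
      (b.constr K).toEquiv.subtypeEquiv fun v => by
        refine ⟨fun hv => b.injective_constr_of_linearIndependent (R₂ := K) hv, fun hf => ?_⟩
        have h1 := b.linearIndependent.map' (b.constr K v) (LinearMap.ker_eq_bot.2 hf)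
        have h2 : (b.constr K v) ∘ b = v := funext fun i => b.constr_basis K v i
        rwa [h2] at h1
    rw [← Nat.card_congr e, card_linearIndependent (by omega), injCount, hW,
      Nat.card_eq_fintype_card, Finset.prod_range]

/-- Transposition is a bijection between Hom spaces that turns surjections into injections of the
duals. -/
theorem card_surjective {r m : ℕ} (hV : finrank K V = m) (hW : finrank K W = r) :
    Nat.card {f : V →ₗ[K] W // Function.Surjective f} = injCount (Nat.card K) r m := by
  have hinj : Function.Injective (Dual.transpose (R := K) (M := V) (M' := W)) := by
    intro u u' h
    refine LinearMap.ext fun v => ?_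
    rw [← sub_eq_zero, ← forall_dual_apply_eq_zero_iff K]
    intro φ
    have := LinearMap.congr_fun (LinearMap.congr_fun h φ) v
    simpa [sub_eq_zero, Dual.transpose_apply] using this
  let e := LinearMap.linearEquivOfInjective (V := V →ₗ[K] W) (V₂ := Dual K W →ₗ[K] Dual K V)
    (Dual.transpose (R := K) (M := V) (M' := W)) hinj (by
    rw [finrank_linearMap K K V W, finrank_linearMap K K (Dual K W) (Dual K V), Subspace.dual_finrank_eq,
      Subspace.dual_finrank_eq, mul_comm])
  rw [← card_injective (K := K) (V := Dual K W) (W := Dual K V) (r := r) (m := m) (by simpa)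
    (by simpa)]
  refine Nat.card_congr (e.toEquiv.subtypeEquiv fun f => ?_)
  exact LinearMap.dualMap_injective_iff.symm

/-- The number of linear maps that are injective on a given subspace. -/
theorem card_injective_domRestrict (D : Submodule K V) {r b a : ℕ} (hV : finrank K V = r)
    (hD : finrank K D = b) (hW : finrank K W = a) :
    Nat.card {f : V →ₗ[K] W // Function.Injective (f.domRestrict D)} =
      Nat.card K ^ (a * (r - b)) * injCount (Nat.card K) b a := by
  -- A map is an injection on `D` and an arbitrary map on a complement `E`.
  obtain ⟨E, hDE⟩ := D.exists_isCompl
  have hE : finrank K E = r - b := by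
    have := Submodule.finrank_add_eq_of_isCompl hDE
    omega
  have e : {f : V →ₗ[K] W // Function.Injective (f.domRestrict D)} ≃
      {g : (D →ₗ[K] W) × (E →ₗ[K] W) // Function.Injective g.1 ∧ True} :=
    (LinearMap.ofIsComplProdEquiv hDE).symm.toEquiv.subtypeEquiv fun f =>
      ⟨fun h => ⟨h, trivial⟩, fun h => h.1⟩
  have e2 : {g : (D →ₗ[K] W) × (E →ₗ[K] W) // Function.Injective g.1 ∧ True} ≃
      {g : D →ₗ[K] W // Function.Injective g} × {g : E →ₗ[K] W // True} :=
    Equiv.subtypeProdEquivProd (p := fun g : D →ₗ[K] W => Function.Injective g)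
      (q := fun g : E →ₗ[K] W => True)
  rw [Nat.card_congr e, Nat.card_congr e2, Nat.card_prod, card_injective hD hW,
    Nat.card_congr (Equiv.subtypeUnivEquiv fun _ => trivial),
    Module.natCard_eq_pow_finrank (K := K) (V := E →ₗ[K] W), finrank_linearMap, hE, hW, mul_comm, mul_comm a]

/-- The number of injective maps `ι` with `π ∘ ι = C`, for a given surjection `π`. -/
theorem card_injective_lift {π : V →ₗ[K] W} (hπ : Function.Surjective π) (C : End K W)
    {r b a : ℕ} (hV : finrank K V = a + r) (hW : finrank K W = r)
    (hC : finrank K (LinearMap.ker C) = b) :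
    Nat.card {ι : W →ₗ[K] V // Function.Injective ι ∧ π ∘ₗ ι = C} =
      Nat.card K ^ (a * (r - b)) * injCount (Nat.card K) b a := by
  -- With a section `σ`, the lifts of `C` are `σ ∘ C + B` with `B : W → ker π`; such a lift is
  -- injective iff `B` is injective on `ker C`.
  obtain ⟨σ, hσ⟩ := π.exists_rightInverse_of_surjective (LinearMap.range_eq_top.2 hπ)
  have hσ' : ∀ w, π (σ w) = w := fun w => LinearMap.congr_fun hσ w
  have hker : finrank K (LinearMap.ker π) = a := by
    have := π.finrank_range_add_finrank_ker
    rw [LinearMap.range_eq_top.2 hπ, finrank_top] at this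
    omega
  rw [← card_injective_domRestrict (LinearMap.ker C) hW hC hker]
  symm
  have hinj : ∀ B : W →ₗ[K] LinearMap.ker π,
      Function.Injective (σ ∘ₗ C + (LinearMap.ker π).subtype ∘ₗ B) ↔
        Function.Injective (B.domRestrict (LinearMap.ker C)) := by
    intro B
    rw [← LinearMap.ker_eq_bot, ← LinearMap.ker_eq_bot, LinearMap.ker_eq_bot',
      LinearMap.ker_eq_bot']
    constructor
    · rintro h ⟨w, hw⟩ hB
      have hw' : C w = 0 := hw
      have hB' : B w = 0 := hB
      exact Subtype.ext (h w (by simp [hw', hB']))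
    · intro h w hw
      have hCw : C w = 0 := by
        have := congrArg π hw
        simpa [hσ'] using this
      have hBw : B w = 0 := by
        ext
        simpa [hCw] using hw
      exact Subtype.ext_iff.1 (h ⟨w, hCw⟩ hBw)
  refine Nat.card_eq_of_bijective (fun B : {f : W →ₗ[K] LinearMap.ker π //
    Function.Injective (f.domRestrict (LinearMap.ker C))} =>
      ⟨σ ∘ₗ C + (LinearMap.ker π).subtype ∘ₗ B.1, (hinj B.1).2 B.2, ?_⟩) ⟨?_, ?_⟩
  · ext w
    simp [hσ']
  · rintro ⟨B, hB⟩ ⟨B', hB'⟩ h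
    have h' := add_left_cancel (Subtype.ext_iff.1 h)
    refine Subtype.ext (LinearMap.ext fun w => Subtype.ext ?_)
    exact LinearMap.congr_fun h' w
  · rintro ⟨ι, hι, hc⟩
    have hc' : ∀ w, π (ι w) = C w := fun w => LinearMap.congr_fun hc w
    let B : W →ₗ[K] LinearMap.ker π := (ι - σ ∘ₗ C).codRestrict _ fun w => by
      simp [hσ', hc']
    have hB : σ ∘ₗ C + (LinearMap.ker π).subtype ∘ₗ B = ι := by
      ext w
      simp [B]
    exact ⟨⟨B, (hinj B).1 (by rwa [hB])⟩, Subtype.ext hB⟩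

end Counting

/-- The factorizations `N = ι ∘ π` of an endomorphism through a space whose dimension is the
rank of `N`. -/
theorem card_rank_factorization {K V W : Type*} [Field K] [AddCommGroup V] [Module K V]
    [AddCommGroup W] [Module K W] [FiniteDimensional K V] [FiniteDimensional K W]
    {r a : ℕ} (hV : finrank K V = a + r) (hW : finrank K W = r)
    {N : End K V} (hN : finrank K (LinearMap.ker N) = a) :
    Nat.card {y : {π : V →ₗ[K] W // Function.Surjective π} ×
        {ι : W →ₗ[K] V // Function.Injective ι} // y.2.1 ∘ₗ y.1.1 = N} =
      Nat.card (GL (Fin r) K) := by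
  have hr : finrank K (LinearMap.range N) = r := by
    have := N.finrank_range_add_finrank_ker
    omega
  rw [← card_linearEquiv hW hr]
  symm
  refine Nat.card_eq_of_bijective (fun e : W ≃ₗ[K] LinearMap.range N =>
    ⟨(⟨e.symm.toLinearMap ∘ₗ N.rangeRestrict, ?_⟩,
      ⟨(LinearMap.range N).subtype ∘ₗ e.toLinearMap, ?_⟩), ?_⟩) ⟨?_, ?_⟩
  · exact e.symm.surjective.comp N.surjective_rangeRestrict
  · exact (Submodule.subtype_injective _).comp e.injective
  · ext v
    simp
  · intro e e' h
    have h' := Subtype.ext_iff.1 (Prod.ext_iff.1 (Subtype.ext_iff.1 h)).2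
    exact LinearEquiv.ext fun w => Subtype.ext (LinearMap.congr_fun h' w)
  · rintro ⟨⟨⟨π, hπ⟩, ⟨ι, hι⟩⟩, h⟩
    have h' : ∀ v, ι (π v) = N v := fun v => LinearMap.congr_fun h v
    have hmem : ∀ w, ι w ∈ LinearMap.range N := fun w => by
      obtain ⟨v, rfl⟩ := hπ w
      exact ⟨v, (h' v).symm⟩
    let e := LinearMap.linearEquivOfInjective (ι.codRestrict _ hmem)
      (fun w w' hw => hι (Subtype.ext_iff.1 hw)) (hW.trans hr.symm)
    have he : ∀ w, (e w : V) = ι w := fun w => rfl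
    refine ⟨e, Subtype.ext (Prod.ext (Subtype.ext (LinearMap.ext fun v => ?_))
      (Subtype.ext (LinearMap.ext fun w => he w)))⟩
    refine e.symm_apply_eq.2 (Subtype.ext ?_)
    exact ((he _).trans (h' v)).symm

/-- This rests on `(ι π) ^ (s + 1) = ι (π ι) ^ s π`, where `ι` and `π` can be cancelled. -/
theorem comp_pow_succ_eq_zero_iff {K V W : Type*} [Field K] [AddCommGroup V] [Module K V]
    [AddCommGroup W] [Module K W] {π : V →ₗ[K] W} {ι : W →ₗ[K] V} (hπ : Function.Surjective π)
    (hι : Function.Injective ι) (s : ℕ) :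
    (ι ∘ₗ π : End K V) ^ (s + 1) = 0 ↔ (π ∘ₗ ι : End K W) ^ s = 0 := by
  have h : ∀ v, ((ι ∘ₗ π : End K V) ^ (s + 1)) v = ι (((π ∘ₗ ι : End K W) ^ s) (π v)) := by
    intro v
    rw [pow_succ', Module.End.mul_apply, ← semiconj_pow (N := (ι ∘ₗ π : End K V))
      (N' := (π ∘ₗ ι : End K W)) (g := π) (fun v => rfl) s v]
    rfl
  constructor
  · intro h0
    refine LinearMap.ext fun w => hι ?_
    obtain ⟨v, rfl⟩ := hπ w
    rw [← h, h0]
    simp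
  · intro h0
    refine LinearMap.ext fun v => ?_
    rw [h, h0]
    simp

/-- The number of endomorphisms `N` of `K ^ m` with `N ^ s = 0` and `dim ker N = a`. -/
noncomputable def nilCount (K : Type*) [Field K] (s m a : ℕ) : ℕ :=
  Nat.card {N : End K (Fin m → K) // N ^ s = 0 ∧ finrank K (LinearMap.ker N) = a}

variable {K : Type*} [Field K] [Finite K]

/-- Both sides count factorizations `N = ι ∘ π` through `K ^ r`. Starting from `N` there are
`|GL_r|` of them. Alternatively, choose the surjection `π`, then `C = π ∘ ι` with `C ^ s = 0` and `b
= dim ker C`, then an injective lift `ι` of `C`. -/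
theorem nilCount_succ (s a r : ℕ) :
    nilCount K (s + 1) (a + r) a * Nat.card (GL (Fin r) K) =
      injCount (Nat.card K) r (a + r) * ∑ b ∈ Finset.range (r + 1),
        nilCount K s r b * (Nat.card K ^ (a * (r - b)) * injCount (Nat.card K) b a) := by
  have hV : finrank K (Fin (a + r) → K) = a + r := finrank_fin_fun K
  have hW : finrank K (Fin r → K) = r := finrank_fin_fun K
  have := finite_end K (Fin (a + r) → K)
  have := finite_end K (Fin r → K)
  have f1 : Finite ((Fin (a + r) → K) →ₗ[K] (Fin r → K)) := Module.finite_of_finite K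
  have f2 : Finite ((Fin r → K) →ₗ[K] (Fin (a + r) → K)) := Module.finite_of_finite K
  let Y := {y : {π : (Fin (a + r) → K) →ₗ[K] (Fin r → K) // Function.Surjective π} ×
        {ι : (Fin r → K) →ₗ[K] (Fin (a + r) → K) // Function.Injective ι} //
        (y.1.1 ∘ₗ y.2.1 : End K (Fin r → K)) ^ s = 0}
  have h1 : nilCount K (s + 1) (a + r) a * Nat.card (GL (Fin r) K) = Nat.card Y * 1 := by
    refine card_mul_eq_card_mul_of_fibers
      (fun (N : {N : End K (Fin (a + r) → K) // N ^ (s + 1) = 0 ∧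
        finrank K (LinearMap.ker N) = a}) (y : Y) => y.1.2.1 ∘ₗ y.1.1.1 = N.1) ?_ ?_
    · intro N
      rw [← card_rank_factorization hV hW N.2.2]
      refine Nat.card_congr
        { toFun := fun y => ⟨y.1.1, y.2⟩
          invFun := fun y => ⟨⟨y.1, ?_⟩, y.2⟩
          left_inv := fun y => rfl
          right_inv := fun y => rfl }
      rw [← comp_pow_succ_eq_zero_iff y.1.1.2 y.1.2.2, y.2]
      exact N.2.1
    · rintro ⟨⟨⟨π, hπ⟩, ⟨ι, hι⟩⟩, hs⟩
      rw [Nat.card_eq_one_iff_exists]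
      refine ⟨⟨⟨ι ∘ₗ π, (comp_pow_succ_eq_zero_iff hπ hι s).2 hs, ?_⟩, rfl⟩, ?_⟩
      · rw [LinearMap.ker_comp_of_ker_eq_bot _ (LinearMap.ker_eq_bot.2 hι)]
        have := π.finrank_range_add_finrank_ker
        rw [LinearMap.range_eq_top.2 hπ, finrank_top] at this
        omega
      · rintro ⟨N, hN⟩
        exact Subtype.ext (Subtype.ext hN.symm)
  have e : Y ≃ Σ (π : {π : (Fin (a + r) → K) →ₗ[K] (Fin r → K) // Function.Surjective π})
        (C : {C : End K (Fin r → K) // C ^ s = 0}),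
        {ι : (Fin r → K) →ₗ[K] (Fin (a + r) → K) // Function.Injective ι ∧ π.1 ∘ₗ ι = C.1} :=
    { toFun := fun y => ⟨y.1.1, ⟨_, y.2⟩, y.1.2.1, y.1.2.2, rfl⟩
      invFun := fun z => ⟨⟨z.1, ⟨z.2.2.1, z.2.2.2.1⟩⟩, by
        rw [z.2.2.2.2]
        exact z.2.1.2⟩
      left_inv := fun y => rfl
      right_inv := by
        rintro ⟨π, ⟨C, hC⟩, ι, hι, h⟩
        have h' : π.1 ∘ₗ ι = C := h
        subst h'
        rfl }
  have := Fintype.ofFinite {π : (Fin (a + r) → K) →ₗ[K] (Fin r → K) // Function.Surjective π}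
  have := Fintype.ofFinite {C : End K (Fin r → K) // C ^ s = 0}
  rw [h1, mul_one, Nat.card_congr e, Nat.card_sigma]
  simp only [Nat.card_sigma]
  rw [Finset.sum_congr rfl fun π _ => Finset.sum_congr rfl fun C _ =>
    card_injective_lift π.2 C.1 hV hW rfl, Finset.sum_const, Finset.card_univ, smul_eq_mul,
    ← Nat.card_eq_fintype_card, card_surjective hV hW]
  congr 1
  rw [← Finset.sum_fiberwise_of_maps_to
    (g := fun C : {C : End K (Fin r → K) // C ^ s = 0} => finrank K (LinearMap.ker C.1))
    (t := Finset.range (r + 1))]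
  · refine Finset.sum_congr rfl fun b _ => ?_
    rw [Finset.sum_congr rfl (g := fun _ =>
      Nat.card K ^ (a * (r - b)) * injCount (Nat.card K) b a)]
    · rw [Finset.sum_const, smul_eq_mul, nilCount]
      congr 1
      rw [← Fintype.card_subtype, ← Nat.card_eq_fintype_card]
      exact Nat.card_congr (Equiv.subtypeSubtypeEquivSubtypeInter
        (fun C : End K (Fin r → K) => C ^ s = 0) fun C => finrank K (LinearMap.ker C) = b)
    · intro C hC
      rw [(Finset.mem_filter.1 hC).2]
  · intro C _
    have := Submodule.finrank_le (LinearMap.ker C.1)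
    rw [hW] at this
    exact Finset.mem_range.2 (by omega)

end RankRecursion

/-! ### Normalizing the recursion by orders of general linear groups -/

section Ratios

theorem cast_injCount {Q : ℕ} (hQ : 0 < Q) {r m : ℕ} (h : r ≤ m) :
    (injCount Q r m : ℚ) = ∏ i ∈ Finset.range r, ((Q : ℚ) ^ m - (Q : ℚ) ^ i) := by
  rw [injCount, Nat.cast_prod]
  refine Finset.prod_congr rfl fun i hi => ?_
  rw [Nat.cast_sub (Nat.pow_le_pow_right hQ ((Finset.mem_range.1 hi).le.trans h)), Nat.cast_pow,
    Nat.cast_pow]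

theorem prod_Icc_one_eq_prod_range {M : Type*} [CommMonoid M] (f : ℕ → M) (n : ℕ) :
    ∏ j ∈ Finset.Icc 1 n, f j = ∏ i ∈ Finset.range n, f (i + 1) := by
  rw [← Finset.Ico_add_one_right_eq_Icc, Finset.prod_Ico_eq_prod_range, Nat.add_sub_cancel]
  simp only [add_comm]

theorem invPoch_eq_prod_range (Q : ℚ) (n : ℕ) :
    invPoch Q n = ∏ i ∈ Finset.range n, (1 - 1 / Q ^ (i + 1)) :=
  prod_Icc_one_eq_prod_range _ n

section Ratio

variable {K : Type*} [Field K] [Finite K]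

theorem card_GL_eq (n : ℕ) : (Nat.card (GL (Fin n) K) : ℚ) =
    ∏ i ∈ Finset.range n, ((Nat.card K : ℚ) ^ n - (Nat.card K : ℚ) ^ i) := by
  have := Fintype.ofFinite K
  rw [← cast_injCount Nat.card_pos le_rfl, Matrix.card_GL_field, injCount, Finset.prod_range,
    Nat.card_eq_fintype_card]

theorem card_GL_eq_invPoch (n : ℕ) : (Nat.card (GL (Fin n) K) : ℚ) =
    (Nat.card K : ℚ) ^ n ^ 2 * invPoch (Nat.card K) n := by
  have hQ : (Nat.card K : ℚ) ≠ 0 := by exact_mod_cast Nat.card_pos.ne'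
  rw [card_GL_eq, invPoch_eq_prod_range, sq, pow_mul, ← Finset.prod_range_reflect]
  conv_rhs => rw [← Finset.card_range n, ← Finset.prod_const, Finset.card_range,
    ← Finset.prod_mul_distrib]
  refine Finset.prod_congr rfl fun i hi => ?_
  obtain ⟨k, rfl⟩ := Nat.exists_eq_add_of_lt (Finset.mem_range.1 hi)
  rw [show i + k + 1 - 1 - i = k by omega]
  field_simp
  ring

/-- In the product for `|GL_(a+r)|`, the first `r` factors count injections and each of the last `a`
yields a factor `Q ^ r`. -/
theorem injCount_mul_card_GL (r a : ℕ) :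
    (injCount (Nat.card K) r (a + r) : ℚ) *
        ((Nat.card K : ℚ) ^ (r * a) * Nat.card (GL (Fin a) K)) =
      Nat.card (GL (Fin (a + r)) K) := by
  rw [card_GL_eq, card_GL_eq, cast_injCount Nat.card_pos (Nat.le_add_left r a), add_comm a r,
    Finset.prod_range_add, pow_mul]
  congr 1
  conv_lhs => rw [← Finset.card_range a, ← Finset.prod_const, Finset.card_range,
    ← Finset.prod_mul_distrib]
  refine Finset.prod_congr rfl fun i _ => ?_
  rw [mul_sub, ← pow_add, ← pow_add]

/-- Here `injCount b a` is `|GL_a| / (Q ^ (b(a-b)) |GL_(a-b)|)`, and the powers of `Q` collect to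
`(a - b)² + 2ab - b² = a²`. -/
theorem nilCount_succ_div (s a r : ℕ) :
    (nilCount K (s + 1) (a + r) a : ℚ) / Nat.card (GL (Fin (a + r)) K) =
      ∑ b ∈ Finset.range (r + 1), (nilCount K s r b : ℚ) / Nat.card (GL (Fin r) K) *
        if b ≤ a then 1 / ((Nat.card K : ℚ) ^ a ^ 2 * invPoch (Nat.card K) (a - b)) else 0 := by
  have hQ : (Nat.card K : ℚ) ≠ 0 := by exact_mod_cast Nat.card_pos.ne'
  have h := congrArg (Nat.cast : ℕ → ℚ) (nilCount_succ (K := K) s a r)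
  push_cast at h
  have h1 := card_GL_ne_zero (F := K) r
  have h2 := card_GL_ne_zero (F := K) (a + r)
  have h3 := card_GL_ne_zero (F := K) a
  have h4 := injCount_mul_card_GL (K := K) r a
  have h5 : (nilCount K (s + 1) (a + r) a : ℚ) / Nat.card (GL (Fin (a + r)) K) =
      (∑ b ∈ Finset.range (r + 1), (nilCount K s r b : ℚ) *
        ((Nat.card K : ℚ) ^ (a * (r - b)) * injCount (Nat.card K) b a)) /
        (Nat.card (GL (Fin r) K) * ((Nat.card K : ℚ) ^ (r * a) * Nat.card (GL (Fin a) K))) := by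
    rw [div_eq_div_iff h2 (by positivity), ← h4]
    linear_combination ((Nat.card K : ℚ) ^ (r * a) * Nat.card (GL (Fin a) K)) * h
  rw [h5, Finset.sum_div]
  refine Finset.sum_congr rfl fun b hb => ?_
  have hbr : b ≤ r := Nat.lt_succ_iff.1 (Finset.mem_range.1 hb)
  split_ifs with hba
  · obtain ⟨c, rfl⟩ := Nat.exists_eq_add_of_le' hba
    obtain ⟨d, rfl⟩ := Nat.exists_eq_add_of_le' hbr
    have h6 := injCount_mul_card_GL (K := K) b c
    have h7 := card_GL_ne_zero (F := K) c
    have h8 := card_GL_eq_invPoch (K := K) c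
    rw [Nat.add_sub_cancel, Nat.add_sub_cancel, ← h6]
    have h9 : (injCount (Nat.card K) b (c + b) : ℚ) ≠ 0 := fun h0 => by
      rw [h0, zero_mul] at h6
      exact h3 h6.symm
    have h10 : invPoch (Nat.card K) c ≠ 0 := fun h0 => by
      rw [h0, mul_zero] at h8
      exact h7 h8
    rw [h8]
    field_simp
    ring
  -- For `b > a` no injection of `ker C` into `ker π` exists, so the term vanishes.
  · rw [injCount_eq_zero (by omega)]
    simp

end Ratio

end Ratios

/-! ### Partitions: deleting the first column -/

section Columns

/-- `Q ^ (∑ᵢ (λ'_i)²) * ∏ᵢ (1/Q)_{m_i(λ)}` for a multiset `λ`, with `i` running up to `n`. -/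
def multisetWeight (Q : ℚ) (P : Multiset ℕ) (n : ℕ) : ℚ :=
  Q ^ (∑ i ∈ Finset.range n, (P.filter (fun k => i + 1 ≤ k)).card ^ 2) *
    ∏ i ∈ Finset.range n, invPoch Q (P.count (i + 1))

theorem invPoch_zero (Q : ℚ) : invPoch Q 0 = 1 := by simp [invPoch]

/-- Beyond the largest part every column is empty and every multiplicity is zero, so the cutoff is
free to vary. -/
theorem multisetWeight_of_le (Q : ℚ) {P : Multiset ℕ} {m n : ℕ} (hP : ∀ i ∈ P, i ≤ m)
    (h : m ≤ n) : multisetWeight Q P n = multisetWeight Q P m := by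
  obtain ⟨k, rfl⟩ := Nat.exists_eq_add_of_le h
  rw [multisetWeight, multisetWeight, Finset.sum_range_add, Finset.prod_range_add]
  have h1 : ∀ i, (P.filter (fun k => m + i + 1 ≤ k)).card = 0 := by
    intro i
    rw [Multiset.card_eq_zero, Multiset.filter_eq_nil]
    intro a ha
    have := hP a ha
    omega
  have h2 : ∀ i, P.count (m + i + 1) = 0 := by
    intro i
    rw [Multiset.count_eq_zero]
    intro ha
    have := hP _ ha
    omega
  simp only [h1, h2, invPoch_zero]
  simp

theorem centralizerWeight_eq (Q : ℚ) {m n : ℕ} (lam : m.Partition) (h : m ≤ n) :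
    centralizerWeight Q lam = multisetWeight Q lam.parts n := by
  rw [multisetWeight_of_le Q (fun i hi => lam.le_of_mem_parts hi) h, centralizerWeight,
    multisetWeight, prod_Icc_one_eq_prod_range]
  congr 2
  rw [← Finset.Ico_add_one_right_eq_Icc, Finset.sum_Ico_eq_sum_range, Nat.add_sub_cancel]
  simp only [add_comm 1, transposePart]

/-- Adding a first column of height `a` to a partition, on the level of multisets of parts. -/
def addColumn (a : ℕ) (P : Multiset ℕ) : Multiset ℕ :=
  P.map (· + 1) + Multiset.replicate (a - P.card) 1

/-- Removing the first column of a partition, on the level of multisets of parts. -/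
def removeColumn (P : Multiset ℕ) : Multiset ℕ := (P.map (· - 1)).filter (· ≠ 0)

theorem removeColumn_addColumn (a : ℕ) {P : Multiset ℕ} (hP : ∀ i ∈ P, 0 < i) :
    removeColumn (addColumn a P) = P := by
  rw [removeColumn, addColumn, Multiset.map_add, Multiset.map_map, Multiset.map_replicate,
    Multiset.filter_add, (Multiset.filter_eq_nil (s := Multiset.replicate _ _)).2]
  · simp only [Function.comp_def, Nat.add_sub_cancel, Multiset.map_id', add_zero]
    exact Multiset.filter_eq_self.2 fun i hi => (hP i hi).ne'
  · intro i hi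
    simp [Multiset.eq_of_mem_replicate hi]

/-- Parts equal to `1` are lost when the column is removed; the prescribed height `P.card` recovers
how many there were. -/
theorem addColumn_removeColumn {P : Multiset ℕ} (hP : ∀ i ∈ P, 0 < i) :
    addColumn P.card (removeColumn P) = P := by
  have h1 : removeColumn P = (P.filter (· ≠ 1)).map (· - 1) := by
    rw [removeColumn, Multiset.filter_map]
    congr 1
    refine Multiset.filter_congr fun i hi => ?_
    have := hP i hi
    simp only [Function.comp]
    omega
  have h2 : P.filter (· ≠ 1) + Multiset.replicate (P.count 1) 1 = P := by
    rw [← Multiset.filter_eq', add_comm]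
    exact Multiset.filter_add_not (· = 1) P
  have h3 : (P.filter (· ≠ 1)).card + P.count 1 = P.card := by
    have := congrArg Multiset.card h2
    simpa using this
  rw [addColumn, h1, Multiset.card_map, Multiset.map_map, ← h3, Nat.add_sub_cancel_left]
  refine Eq.trans ?_ h2
  congr 1
  conv_rhs => rw [← Multiset.map_id (P.filter (· ≠ 1))]
  refine Multiset.map_congr rfl fun i hi => ?_
  have := hP i (Multiset.mem_filter.1 hi).1
  simp only [Function.comp, id]
  omega

theorem card_addColumn {a : ℕ} {P : Multiset ℕ} (h : P.card ≤ a) : (addColumn a P).card = a := by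
  simp only [addColumn, Multiset.card_add, Multiset.card_map, Multiset.card_replicate]
  omega

theorem sum_addColumn {a : ℕ} {P : Multiset ℕ} (h : P.card ≤ a) :
    (addColumn a P).sum = P.sum + a := by
  rw [addColumn, Multiset.sum_add, Multiset.sum_map_add, Multiset.map_id', Multiset.map_const',
    Multiset.sum_replicate, Multiset.sum_replicate]
  simp only [smul_eq_mul, mul_one]
  omega

theorem card_removeColumn_le (P : Multiset ℕ) : (removeColumn P).card ≤ P.card :=
  (Multiset.card_le_card (Multiset.filter_le _ _)).trans (Multiset.card_map _ _).le

/-- The new column contributes `a²` to the exponent and creates `a - P.card` parts equal to `1`; all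
other columns and multiplicities are shifted by one index. -/
theorem multisetWeight_addColumn (Q : ℚ) {a : ℕ} {P : Multiset ℕ} (hP : ∀ i ∈ P, 0 < i)
    (hcard : P.card ≤ a) (n : ℕ) :
    multisetWeight Q (addColumn a P) (n + 1) =
      Q ^ a ^ 2 * invPoch Q (a - P.card) * multisetWeight Q P n := by
  have h1 : ((addColumn a P).filter (fun k => 0 + 1 ≤ k)).card = a := by
    rw [Multiset.filter_eq_self.2]
    · exact card_addColumn hcard
    · intro i hi
      rcases Multiset.mem_add.1 hi with hi | hi
      · obtain ⟨j, _, rfl⟩ := Multiset.mem_map.1 hi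
        omega
      · rw [Multiset.eq_of_mem_replicate hi]
  have h2 : ∀ i, ((addColumn a P).filter (fun k => i + 1 + 1 ≤ k)).card =
      (P.filter (fun k => i + 1 ≤ k)).card := by
    intro i
    rw [addColumn, Multiset.filter_add, Multiset.filter_map,
      (Multiset.filter_eq_nil (s := Multiset.replicate _ _)).2]
    · simp
    · intro j hj
      rw [Multiset.eq_of_mem_replicate hj]
      omega
  have h3 : ∀ i, (addColumn a P).count (i + 1) = P.count i + if i = 0 then a - P.card else 0 := by
    intro i
    rw [addColumn, Multiset.count_add, Multiset.count_map_eq_count' _ _ (add_left_injective 1),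
      Multiset.count_replicate]
    simp
  have h4 : P.count 0 = 0 := Multiset.count_eq_zero.2 fun h => (hP 0 h).ne' rfl
  rw [multisetWeight, multisetWeight, Finset.sum_range_succ', Finset.prod_range_succ', h1]
  simp only [h2, h3, h4]
  simp only [Nat.add_eq_zero_iff, one_ne_zero, and_false, if_false, add_zero, if_true, zero_add]
  rw [pow_add]
  ring

/-- The sum of `1 / centralizerWeight Q λ` over the partitions of `m` with parts at most `s` and
exactly `a` parts. -/
def partitionSum (Q : ℚ) (s m a : ℕ) : ℚ :=
  ∑ lam : m.Partition with (∀ i ∈ lam.parts, i ≤ s) ∧ lam.parts.card = a,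
    1 / centralizerWeight Q lam

/-- Removing the first column, of height `a`, is a bijection onto partitions of `r` with parts at
most `s` and some number `b ≤ a` of parts. The coefficients are those of `nilCount_succ_div`. -/
theorem partitionSum_succ (Q : ℚ) (s a r : ℕ) :
    partitionSum Q (s + 1) (a + r) a =
      ∑ b ∈ Finset.range (r + 1), partitionSum Q s r b *
        if b ≤ a then 1 / (Q ^ a ^ 2 * invPoch Q (a - b)) else 0 := by
  have hpos : ∀ {m : ℕ} (lam : m.Partition), ∀ i ∈ lam.parts, 0 < i := fun lam i hi =>
    lam.parts_pos hi
  have hcard : ∀ lam : r.Partition, lam.parts.card ≤ r := fun lam => by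
    simpa [lam.parts_sum] using Multiset.card_nsmul_le_sum (a := 1) (fun i hi => hpos lam i hi)
  have hadd : ∀ mu : r.Partition, mu.parts.card ≤ a → (addColumn a mu.parts).sum = a + r :=
    fun mu h => by rw [sum_addColumn h, mu.parts_sum, add_comm]
  have haddpos : ∀ (mu : r.Partition) {i : ℕ}, i ∈ addColumn a mu.parts → 0 < i := by
    intro mu i hi
    rcases Multiset.mem_add.1 hi with hi | hi
    · obtain ⟨j, _, rfl⟩ := Multiset.mem_map.1 hi
      omega
    · rw [Multiset.eq_of_mem_replicate hi]
      exact one_pos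
  have hrem : ∀ lam : (a + r).Partition, lam.parts.card = a →
      (removeColumn lam.parts).sum = r := by
    intro lam h
    have h1 := sum_addColumn (card_removeColumn_le lam.parts)
    rw [addColumn_removeColumn (hpos lam), lam.parts_sum, h] at h1
    omega
  have hrempos : ∀ (lam : (a + r).Partition) {i : ℕ}, i ∈ removeColumn lam.parts → 0 < i :=
    fun lam i hi => Nat.pos_of_ne_zero (Multiset.mem_filter.1 hi).2
  have hR : ∀ b, partitionSum Q s r b *
      (if b ≤ a then 1 / (Q ^ a ^ 2 * invPoch Q (a - b)) else 0) =
      ∑ mu : r.Partition with ((∀ i ∈ mu.parts, i ≤ s) ∧ mu.parts.card ≤ a) ∧ mu.parts.card = b,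
        1 / (Q ^ a ^ 2 * invPoch Q (a - mu.parts.card) * centralizerWeight Q mu) := by
    intro b
    split_ifs with hb
    · rw [partitionSum, Finset.sum_mul]
      refine Finset.sum_congr (Finset.filter_congr fun mu _ => ?_) fun mu hmu => ?_
      · constructor
        · rintro ⟨h1, h2⟩
          exact ⟨⟨h1, h2.le.trans hb⟩, h2⟩
        · rintro ⟨⟨h1, _⟩, h2⟩
          exact ⟨h1, h2⟩
      · rw [(Finset.mem_filter.1 hmu).2.2, one_div_mul_one_div, mul_comm]
    · rw [mul_zero, Finset.filter_eq_empty_iff.2, Finset.sum_empty]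
      rintro mu _ ⟨⟨_, h1⟩, h2⟩
      omega
  simp only [hR]
  rw [partitionSum]
  simp only [← Finset.filter_filter (fun mu : r.Partition => (∀ i ∈ mu.parts, i ≤ s) ∧
    mu.parts.card ≤ a)]
  rw [Finset.sum_fiberwise_of_maps_to
    (g := fun mu : r.Partition => mu.parts.card) fun mu _ =>
      Finset.mem_range.2 (Nat.lt_succ_of_le (hcard mu))]
  refine Finset.sum_bij'
    (fun lam hlam => ⟨removeColumn lam.parts, hrempos lam,
      hrem lam (Finset.mem_filter.1 hlam).2.2⟩)
    (fun mu hmu => ⟨addColumn a mu.parts, haddpos mu, hadd mu (Finset.mem_filter.1 hmu).2.2⟩)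
    ?_ ?_ ?_ ?_ ?_
  · intro lam hlam
    obtain ⟨_, h1, h2⟩ := Finset.mem_filter.1 hlam
    refine Finset.mem_filter.2 ⟨Finset.mem_univ _, fun i hi => ?_,
      (card_removeColumn_le lam.parts).trans h2.le⟩
    obtain ⟨j, hj, rfl⟩ := Multiset.mem_map.1 (Multiset.mem_filter.1 hi).1
    have := h1 j hj
    omega
  · intro mu hmu
    obtain ⟨_, h1, h2⟩ := Finset.mem_filter.1 hmu
    refine Finset.mem_filter.2 ⟨Finset.mem_univ _, fun i hi => ?_, card_addColumn h2⟩
    rcases Multiset.mem_add.1 hi with hi | hi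
    · obtain ⟨j, hj, rfl⟩ := Multiset.mem_map.1 hi
      have := h1 j hj
      omega
    · rw [Multiset.eq_of_mem_replicate hi]
      omega
  · intro lam hlam
    refine Nat.Partition.ext ?_
    obtain ⟨_, _, h2⟩ := Finset.mem_filter.1 hlam
    conv_rhs => rw [← addColumn_removeColumn (hpos lam), h2]
  · intro mu hmu
    exact Nat.Partition.ext (removeColumn_addColumn a (hpos mu))
  · intro lam hlam
    obtain ⟨_, _, h2⟩ := Finset.mem_filter.1 hlam
    have h3 := (card_removeColumn_le lam.parts).trans h2.le
    -- The cutoffs `a + r + 1` and `a + r` are chosen one apart to match the shift of columns.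
    rw [centralizerWeight_eq Q lam (Nat.le_succ (a + r)),
      centralizerWeight_eq Q _ (Nat.le_add_left r a), ← multisetWeight_addColumn Q _ h3]
    · conv_lhs => rw [← addColumn_removeColumn (hpos lam), h2]
    · exact fun i hi => hrempos lam hi

end Columns

/-! ### Nilpotent counts as partition sums -/

section NilpotentCount

theorem card_parts_le {m : ℕ} (lam : m.Partition) : lam.parts.card ≤ m := by
  simpa [lam.parts_sum] using
    Multiset.card_nsmul_le_sum (s := lam.parts) (a := 1) (fun i hi => lam.parts_pos hi)

theorem nilCount_zero_left {K : Type*} [Field K] (m a : ℕ) :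
    nilCount K 0 m a = if m = 0 ∧ a = 0 then 1 else 0 := by
  rw [nilCount]
  rcases Nat.eq_zero_or_pos m with rfl | hm
  · have h0 : ∀ N : End K (Fin 0 → K), finrank K (LinearMap.ker N) = 0 := fun N =>
      finrank_zero_of_subsingleton
    split_ifs with h
    · rw [Nat.card_eq_one_iff_exists]
      exact ⟨⟨0, Subsingleton.elim _ _, by rw [h0, h.2]⟩, fun y => Subsingleton.elim _ _⟩
    · have : IsEmpty {N : End K (Fin 0 → K) // N ^ 0 = 0 ∧ finrank K (LinearMap.ker N) = a} :=
        ⟨fun N => h ⟨rfl, N.2.2.symm.trans (h0 _)⟩⟩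
      exact Nat.card_of_isEmpty
  · rw [if_neg (by omega)]
    have : Nonempty (Fin m) := ⟨⟨0, hm⟩⟩
    have : IsEmpty {N : End K (Fin m → K) // N ^ 0 = 0 ∧ finrank K (LinearMap.ker N) = a} :=
      ⟨fun N => one_ne_zero (α := End K (Fin m → K)) N.2.1⟩
    exact Nat.card_of_isEmpty

section Nilpotent

variable {K : Type*} [Field K] [Finite K]

theorem card_GL_zero : Nat.card (GL (Fin 0) K) = 1 := by
  have := Fintype.ofFinite K
  rw [Matrix.card_GL_field]
  simp

theorem centralizerWeight_zero (Q : ℚ) (lam : (0 : ℕ).Partition) :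
    centralizerWeight Q lam = 1 := by
  simp [centralizerWeight]

theorem partitionSum_zero (Q : ℚ) (m a : ℕ) :
    partitionSum Q 0 m a = if m = 0 ∧ a = 0 then 1 else 0 := by
  rw [partitionSum]
  rcases Nat.eq_zero_or_pos m with rfl | hm
  · split_ifs with h
    · rw [Finset.filter_true_of_mem]
      · simp [centralizerWeight_zero]
      · intro lam _
        simp [h.2]
    · rw [Finset.filter_eq_empty_iff.2, Finset.sum_empty]
      rintro lam _ ⟨_, h2⟩
      have := card_parts_le lam
      omega
  · rw [if_neg (by omega), Finset.filter_eq_empty_iff.2, Finset.sum_empty]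
    rintro lam _ ⟨h1, _⟩
    have h2 : lam.parts = 0 := Multiset.eq_zero_of_forall_notMem fun i hi => by
      have := lam.parts_pos hi
      have := h1 i hi
      omega
    have := lam.parts_sum
    rw [h2, Multiset.sum_zero] at this
    omega

/-- Induction on `s`, as both sides obey one recursion. At `s = 0` the condition `N ^ 0 = 0` leaves
only the zero space, just as parts at most `0` leave only the empty partition. -/
theorem nilCount_div_card_GL (s m a : ℕ) :
    (nilCount K s m a : ℚ) / Nat.card (GL (Fin m) K) = partitionSum (Nat.card K) s m a := by
  induction s generalizing m a with
  | zero =>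
    rw [nilCount_zero_left, partitionSum_zero]
    split_ifs with h
    · rw [h.1, card_GL_zero]
      simp
    · simp
  | succ s ih =>
    rcases le_or_gt a m with h | h
    · obtain ⟨r, rfl⟩ := Nat.exists_eq_add_of_le h
      rw [nilCount_succ_div, partitionSum_succ]
      simp only [ih]
    · have : IsEmpty {N : End K (Fin m → K) //
          N ^ (s + 1) = 0 ∧ finrank K (LinearMap.ker N) = a} := ⟨fun N => by
        have h1 := Submodule.finrank_le (LinearMap.ker N.1)
        rw [N.2.2, finrank_fin_fun] at h1
        omega⟩
      rw [nilCount, Nat.card_of_isEmpty, partitionSum, Finset.filter_eq_empty_iff.2,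
        Finset.sum_empty, Nat.cast_zero, zero_div]
      rintro lam _ ⟨_, h2⟩
      have := card_parts_le lam
      omega

/-- The weighted number of endomorphisms `N` of `K ^ m` with `N ^ s = 0` is the sum of the
reciprocals of the centralizer orders of the Jordan types. -/
theorem card_pow_eq_zero_div_card_GL (s m : ℕ) :
    (Nat.card {N : End K (Fin m → K) // N ^ s = 0} : ℚ) / Nat.card (GL (Fin m) K) =
      ∑ lam : m.Partition with ∀ i ∈ lam.parts, i ≤ s,
        1 / centralizerWeight (Nat.card K : ℚ) lam := by
  have := finite_end K (Fin m → K)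
  rw [← Finset.sum_fiberwise_of_maps_to (t := Finset.range (m + 1))
    (g := fun lam : m.Partition => lam.parts.card) fun lam _ =>
      Finset.mem_range.2 (Nat.lt_succ_of_le (card_parts_le lam))]
  simp only [Finset.filter_filter]
  refine Eq.trans ?_ (Finset.sum_congr rfl fun a _ => nilCount_div_card_GL (K := K) s m a)
  rw [← Finset.sum_div, ← Nat.cast_sum]
  congr 2
  have := Fintype.ofFinite {N : End K (Fin m → K) // N ^ s = 0}
  rw [Nat.card_eq_fintype_card, ← Finset.card_univ,
    Finset.card_eq_sum_card_fiberwise (t := Finset.range (m + 1))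
      (f := fun N : {N : End K (Fin m → K) // N ^ s = 0} => finrank K (LinearMap.ker N.1))]
  · refine Finset.sum_congr rfl fun a _ => ?_
    rw [nilCount, ← Fintype.card_subtype, ← Nat.card_eq_fintype_card]
    exact Nat.card_congr (Equiv.subtypeSubtypeEquivSubtypeInter
        (fun N : End K (Fin m → K) => N ^ s = 0) fun N => finrank K (LinearMap.ker N) = a)
  · intro N _
    have := Submodule.finrank_le (LinearMap.ker N.1)
    rw [finrank_fin_fun] at this
    simp only [Finset.coe_range, Set.mem_Iio]
    omega

end Nilpotent

end NilpotentCount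

/-! ### Assembly over the factors of `X ^ t - 1` -/

section GeneratingFunction

theorem card_jordanPairs_fin_zero {F : Type*} [Field F] (f : F[X]) (s : ℕ) :
    Nat.card (jordanPairs f s (Fin 0 → F)) = 1 := by
  rw [Nat.card_eq_one_iff_exists]
  exact ⟨⟨(0, 0), Subsingleton.elim _ _, Subsingleton.elim _ _, Subsingleton.elim _ _⟩,
    fun _ => Subsingleton.elim _ _⟩

theorem separable_X_pow_sub_one {F : Type*} [Field F] {p t : ℕ} [Fact p.Prime] [CharP F p] (ht : ¬ p ∣ t) :
    (X ^ t - 1 : F[X]).Separable := by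
  refine X_pow_sub_one_separable_iff.2 fun h => ht ?_
  exact (CharP.cast_eq_zero_iff F p t).1 h


variable {F : Type*} [Field F] [Fintype F]

theorem coeff_partitionFactor {q e s : ℕ} (he : 0 < e) (m : ℕ) :
    PowerSeries.coeff (e * m) (partitionFactor q e s) =
      ∑ lam : m.Partition with ∀ i ∈ lam.parts, i ≤ s,
        1 / centralizerWeight ((q : ℚ) ^ e) lam := by
  rw [partitionFactor, map_add, PowerSeries.coeff_mk, PowerSeries.coeff_one]
  rcases Nat.eq_zero_or_pos m with rfl | hm
  -- The constant term is the explicit `1 +` of the factor; it matches the empty partition.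
  · simp [centralizerWeight_zero]
  · rw [if_neg (mul_pos he hm).ne', zero_add]
    have : (Finset.Icc 1 (e * m)).filter (fun m' => m' * e = e * m) = {m} := by
      ext m'
      simp only [Finset.mem_filter, Finset.mem_Icc, Finset.mem_singleton]
      constructor
      · rintro ⟨_, h⟩
        rw [mul_comm] at h
        exact Nat.eq_of_mul_eq_mul_left he h
      · rintro rfl
        exact ⟨⟨hm, Nat.le_mul_of_pos_left _ he⟩, mul_comm _ _⟩
    rw [this, Finset.sum_singleton]

theorem coeff_partitionFactor_of_not_dvd {q e s n : ℕ} (hn : ¬ e ∣ n) :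
    PowerSeries.coeff n (partitionFactor q e s) = 0 := by
  rw [partitionFactor, map_add, PowerSeries.coeff_mk, PowerSeries.coeff_one,
    if_neg (by rintro rfl; exact hn (dvd_zero e)), zero_add, Finset.filter_eq_empty_iff.2,
    Finset.sum_empty]
  rintro m _ rfl
  exact hn (dvd_mul_left e m)

theorem pairSeries_irreducible {φ : F[X]} (hφ : Irreducible φ) (s : ℕ) :
    pairSeries φ s = partitionFactor (Fintype.card F) φ.natDegree s := by
  have : Fact (Irreducible φ) := ⟨hφ⟩
  have := finiteDimensional_adjoinRoot (φ := φ)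
  have : Finite (AdjoinRoot φ) := Module.finite_of_finite F
  ext n
  by_cases hn : φ.natDegree ∣ n
  · obtain ⟨m, rfl⟩ := hn
    have hQ : (Nat.card (AdjoinRoot φ) : ℚ) = (Fintype.card F : ℚ) ^ φ.natDegree := by
      rw [Module.natCard_eq_pow_finrank (K := F), finrank_adjoinRoot, Nat.card_eq_fintype_card]
      push_cast
      rfl
    rw [coeff_pairSeries_irreducible, coeff_partitionFactor hφ.natDegree_pos,
      card_pow_eq_zero_div_card_GL, hQ]
  · rw [coeff_pairSeries_irreducible_of_not_dvd _ _ hn, coeff_partitionFactor_of_not_dvd hn]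

theorem pairSeries_one (s : ℕ) : pairSeries (1 : F[X]) s = 1 := by
  ext n
  rw [pairSeries, PowerSeries.coeff_mk, PowerSeries.coeff_one]
  split_ifs with hn
  · subst hn
    rw [card_jordanPairs_fin_zero, card_GL_zero]
    simp
  · have : Nonempty (Fin n) := ⟨⟨0, Nat.pos_of_ne_zero hn⟩⟩
    have : IsEmpty (jordanPairs (1 : F[X]) s (Fin n → F)) := ⟨fun x => by
      have h := x.2.2.1
      rw [map_one] at h
      exact one_ne_zero h⟩
    rw [Nat.card_of_isEmpty, Nat.cast_zero, zero_div]

theorem pairSeries_prod {ι : Type*} (I : Finset ι) (f : ι → F[X]) (s : ℕ)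
    (h : (I : Set ι).Pairwise fun i j => IsCoprime (f i) (f j)) :
    pairSeries (∏ i ∈ I, f i) s = ∏ i ∈ I, pairSeries (f i) s := by
  classical
  induction I using Finset.induction_on with
  | empty => simp [pairSeries_one]
  | insert a I ha ih =>
    rw [Finset.prod_insert ha, Finset.prod_insert ha, pairSeries_mul, ih]
    · exact h.mono (by simp)
    · refine IsCoprime.prod_right fun i hi => h (by simp) (by simp [hi]) ?_
      rintro rfl
      exact ha hi

/-- The polynomial is squarefree and all its irreducible factors have degree `e(d)`, so there are
`φ(d) / e(d)` of them, each contributing the same series. -/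
theorem pairSeries_cyclotomic {p d : ℕ} [Fact p.Prime] [CharP F p] (hd : ¬ p ∣ d) (s : ℕ) :
    pairSeries (cyclotomic d F) s =
      partitionFactor (Fintype.card F) (ordMod (Fintype.card F) d) s ^
        (d.totient / ordMod (Fintype.card F) d) := by
  classical
  have hp : p.Prime := Fact.out
  obtain ⟨k, _, hk⟩ := FiniteField.card F p
  have hcop : p.Coprime d := (Nat.Prime.coprime_iff_not_dvd hp).2 hd
  have hdpos : 0 < d := Nat.pos_of_ne_zero (by rintro rfl; exact hd (dvd_zero p))
  have hmonic := cyclotomic.monic d F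
  have hsq : Squarefree (cyclotomic d F) := by
    refine (Separable.of_dvd (separable_X_pow_sub_one (p := p) hd) ?_).squarefree
    exact cyclotomic.dvd_X_pow_sub_one d F
  have hdeg : ∀ φ : F[X], φ ∣ cyclotomic d F → Irreducible φ →
      φ.natDegree = ordMod (Fintype.card F) d := by
    intro φ h1 h2
    rw [natDegree_of_dvd_cyclotomic_of_irreducible hk hcop h1 h2, ← ordMod_eq_orderOf_unit, hk]
  set T := UniqueFactorizationMonoid.normalizedFactors (cyclotomic d F)
  have hirr : ∀ φ ∈ T, Irreducible φ := fun φ h =>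
    UniqueFactorizationMonoid.irreducible_of_normalized_factor φ h
  have hdvd : ∀ φ ∈ T, φ ∣ cyclotomic d F := fun φ h =>
    UniqueFactorizationMonoid.dvd_of_mem_normalizedFactors h
  have hnodup : T.Nodup :=
    (UniqueFactorizationMonoid.squarefree_iff_nodup_normalizedFactors hmonic.ne_zero).1 hsq
  have hprod : ∏ φ ∈ T.toFinset, φ = cyclotomic d F := by
    change ∏ φ ∈ T.toFinset, id φ = _
    rw [← Finset.prod_val, Multiset.toFinset_val, hnodup.dedup,
      UniqueFactorizationMonoid.prod_normalizedFactors_eq hmonic.ne_zero,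
      hmonic.normalize_eq_self]
  have hcopr : ((T.toFinset : Finset F[X]) : Set F[X]).Pairwise fun φ ψ => IsCoprime φ ψ := by
    intro φ h1 ψ h2 hne
    rw [Finset.mem_coe, Multiset.mem_toFinset] at h1 h2
    refine (dvd_or_isCoprime φ ψ (hirr φ h1)).resolve_left fun h => hne ?_
    have h3 := (hirr φ h1).associated_of_dvd (hirr ψ h2) h
    rw [← UniqueFactorizationMonoid.normalize_normalized_factor φ h1,
      ← UniqueFactorizationMonoid.normalize_normalized_factor ψ h2]
    exact normalize_eq_normalize_iff_associated.2 h3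
  have hcard : T.toFinset.card * ordMod (Fintype.card F) d = d.totient := by
    rw [← natDegree_cyclotomic d F, ← hprod, natDegree_prod _ _ fun φ h =>
      (hirr φ (Multiset.mem_toFinset.1 h)).ne_zero, ← smul_eq_mul, ← Finset.sum_const]
    refine Finset.sum_congr rfl fun φ h => ?_
    rw [Multiset.mem_toFinset] at h
    exact (hdeg φ (hdvd φ h) (hirr φ h)).symm
  have hpos : 0 < ordMod (Fintype.card F) d := by
    refine Nat.pos_of_ne_zero fun h => ?_
    rw [h, mul_zero] at hcard
    exact (Nat.totient_pos.2 hdpos).ne hcard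
  rw [← hprod, pairSeries_prod _ _ _ hcopr, ← hcard, Nat.mul_div_cancel _ hpos,
    ← Finset.prod_const]
  refine Finset.prod_congr rfl fun φ h => ?_
  rw [Multiset.mem_toFinset] at h
  rw [pairSeries_irreducible (hirr φ h), hdeg φ (hdvd φ h) (hirr φ h)]

theorem pairSeries_X_pow_sub_one {p t : ℕ} [Fact p.Prime] [CharP F p] (ht : ¬ p ∣ t) (s : ℕ) :
    pairSeries (X ^ t - 1 : F[X]) s = ∏ d ∈ t.divisors,
      partitionFactor (Fintype.card F) (ordMod (Fintype.card F) d) s ^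
        (d.totient / ordMod (Fintype.card F) d) := by
  have htpos : 0 < t := Nat.pos_of_ne_zero (by rintro rfl; exact ht (dvd_zero p))
  rw [← prod_cyclotomic_eq_X_pow_sub_one htpos, pairSeries_prod]
  · refine Finset.prod_congr rfl fun d hd => pairSeries_cyclotomic (p := p) (fun h => ht ?_) s
    exact h.trans (Nat.dvd_of_mem_divisors hd)
  · intro d hd d' hd' hne
    classical
    have hsep := separable_X_pow_sub_one (F := F) (p := p) ht
    rw [← prod_cyclotomic_eq_X_pow_sub_one htpos, ← Finset.mul_prod_erase _ _ hd,
      ← Finset.mul_prod_erase _ _ (Finset.mem_erase.2 ⟨hne.symm, hd'⟩), ← mul_assoc] at hsep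
    -- Two factors whose product divides a separable polynomial are coprime.
    exact hsep.of_mul_left.isCoprime

end GeneratingFunction

end RootsOfIdentity

theorem mainTheorem1 (F : Type*) [Field F] [Fintype F] (p : ℕ) [Fact p.Prime] [CharP F p]
    (M t r : ℕ) (hM : M = t * p ^ r) (ht : ¬ p ∣ t) :
    (1 + PowerSeries.mk (fun n : ℕ =>
        if 1 ≤ n then
          (RootsOfIdentity.numRoots F M n : ℚ) /
            (Nat.card (Matrix.GeneralLinearGroup (Fin n) F) : ℚ)
        else 0) : PowerSeries ℚ) =
      ∏ d ∈ t.divisors,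
        RootsOfIdentity.partitionFactor (Fintype.card F)
            (RootsOfIdentity.ordMod (Fintype.card F) d) (p ^ r) ^
          (d.totient / RootsOfIdentity.ordMod (Fintype.card F) d) := by
  subst hM
  rw [← RootsOfIdentity.pairSeries_X_pow_sub_one ht]
  ext n
  rw [map_add, PowerSeries.coeff_mk, PowerSeries.coeff_one, RootsOfIdentity.pairSeries,
    PowerSeries.coeff_mk, RootsOfIdentity.numRoots_eq_card_jordanPairs F p r ht]
  rcases Nat.eq_zero_or_pos n with rfl | hn
  -- The leading `1` of the series is the single pair on the zero space.
  · simp only [RootsOfIdentity.card_jordanPairs_fin_zero, RootsOfIdentity.card_GL_zero]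
    simp
  · rw [if_neg hn.ne', if_pos (Nat.succ_le_of_lt hn), zero_add]
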